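/- Let $(\mathcal A,\cdot)$ be a finite-dimensional commutative associative real algebra (not necessarily unital), $L_a(b)=ab$, and let $L_a^*$ be the transpose of $L_a$ on $\mathcal A^*$. Let $\nabla^0$ be the canonical affine connection of the vector space $\mathcal A^*$ and let $h$ be the symmetric bivector field $h(a,b)(\nu)=\langle\nu,ab\rangle$ on $\mathcal A^*$ ($a,b\in\mathcal A=T^*_\nu\mathcal A^*$), with $h_\#$ given by $\langle h_\#(a),b\rangle=h(a,b)$. Let $X_a=h_\#(a)$, i.e. $X_a(\nu)=L_a^*\nu$. Let $\mu\in\mathcal A^*$ and let $M=M_\mu=\{\exp(L_a^*)\mu : a\in\mathcal A\}$ be its orbit under the action $\Phi(a,\mu)=\exp(L_a^*)(\mu)$ of $(\mathcal A,+)$. Then $M$ is an immersed submanifold of $\mathcal A^*$ with $T_\nu M=\{X_a(\nu):a\in\mathcal A\}$; the $X_a$ restrict to smooth vector fields on $M$, and $M$ carries an induced pseudo-Hessian structure $(\nabla,g)$ (that is, $g$ is a pseudo-Riemannian metric, $\nabla$ is torsionless and flat, and $\nabla g$ is totally symmetric), where $\nabla$ is the restriction of $\nabla^0$ and $g(h_\#(a),h_\#(b))=h(a,b)$;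 the metric $g$ has a Levi-Civita connection $D$. Put $\gamma=D-\nabla$, $\nabla'=2D-\nabla$, $Q=\nabla\gamma$ (with $Q(X,Y)Z=(\nabla_X\gamma)_YZ$), $\alpha(X)=\operatorname{tr}(i_X\gamma)$ and $\beta=\nabla\alpha$. For $\nu\in M$ let $\mathcal A_\nu=\{c\in\mathcal A:\langle\nu,cb\rangle=0\ \text{for all } b\in\mathcal A\}$. This is an ideal, $b\mapsto X_b(\nu)$ identifies $\mathcal A/\mathcal A_\nu$ with $T_\nu M$, and we write $\operatorname{tr}_\nu(L_a)$ for the trace of the endomorphism of $\mathcal A/\mathcal A_\nu\cong T_\nu M$ induced by $L_a$. Then for all $a,b,c\in\mathcal A$ and $\nu\in M$: $$g(X_a(\nu),X_b(\nu))=\langle\nu,ab\rangle,\quad \nabla_{X_a}X_b=X_{ab},\quad D_{X_a}X_b=\tfrac12X_{ab},\quad \nabla'_{X_a}X_b=0,$$ $$Q(X_a,X_b)X_c=\tfrac12X_{abc},\quad \alpha(X_a)(\nu)=-\tfrac12\operatorname{tr}_\nu(L_a),\quad \beta(X_a,X_b)(\nu)=\tfrac12\operatorname{tr}_\nu(L_{ab}).$$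 If $M$ is open in $\mathcal A^*$, then $\alpha(X_a)=-\tfrac12\operatorname{tr}(L_a)$ and $\beta(X_a,X_b)=\tfrac12\operatorname{tr}(L_{ab})$, with the traces taken on $\mathcal A$. Moreover $g$ is flat, and $Q=0$ on $M_\mu$ if and only if $\langle\mu,abcd\rangle=0$ for all $a,b,c,d\in\mathcal A$. Consequently $Q=0$ on every orbit of $\Phi$ if and only if $\mathcal A^4=0$. -/

import Mathlib

open scoped Manifold ContDiff Topology

set_option linter.unusedSectionVars false

namespace PseudoHessian

/-! ## Pseudo-Hessian geometry on a smooth manifold -/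

section Manifold

variable {E : Type*} [NormedAddCommGroup E] [NormedSpace ℝ E]
  {M : Type*} [TopologicalSpace M] [ChartedSpace E M]

/-- (Not necessarily smooth) vector fields on `M`. -/
abbrev VField (E : Type*) [NormedAddCommGroup E] [NormedSpace ℝ E]
    (M : Type*) [TopologicalSpace M] [ChartedSpace E M] :=
  (x : M) → TangentSpace 𝓘(ℝ, E) x

/-- The vector field `X` is smooth. -/
def IsSmooth [IsManifold 𝓘(ℝ, E) ∞ M] (X : VField E M) : Prop :=
  ContMDiff 𝓘(ℝ, E) 𝓘(ℝ, E).tangent ∞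
    (fun x => (⟨x, X x⟩ : TangentBundle 𝓘(ℝ, E) M))

/-- Linear connections on the tangent bundle of `M`. For a connection `C` the value `∇_X Y` at `x`
is `C Y x (X x)`. -/
abbrev Connection (E : Type*) [NormedAddCommGroup E] [NormedSpace ℝ E]
    (M : Type*) [TopologicalSpace M] [ChartedSpace E M] [IsManifold 𝓘(ℝ, E) ∞ M] :=
  CovariantDerivative 𝓘(ℝ, E) E (TangentSpace 𝓘(ℝ, E) : M → Type _)

variable [IsManifold 𝓘(ℝ, E) ∞ M]

/-- `∇_X Y`. -/
noncomputable def nabla (C : Connection E M) (X Y : VField E M) : VField E M :=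
  fun x => C Y x (X x)

/-- The curvature `R(X,Y)Z = ∇_X ∇_Y Z - ∇_Y ∇_X Z - ∇_{[X,Y]} Z`. -/
noncomputable def curvature (C : Connection E M) (X Y Z : VField E M) : VField E M :=
  nabla C X (nabla C Y Z) - nabla C Y (nabla C X Z)
    - nabla C (VectorField.mlieBracket 𝓘(ℝ, E) X Y) Z

/-- The curvature of the connection vanishes. -/
def IsFlat (C : Connection E M) : Prop :=
  ∀ X Y Z : VField E M, IsSmooth X → IsSmooth Y → IsSmooth Z → curvature C X Y Z = 0

/-- The derivative `X(f)` at `x` of the function `f` along the vector field `X`. -/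
noncomputable def dirDeriv (X : VField E M) (f : M → ℝ) (x : M) : ℝ :=
  mvfderiv 𝓘(ℝ, E) f x (X x)

/-- Smooth pseudo-Riemannian metrics on `M`. -/
structure Metric (E : Type*) [NormedAddCommGroup E] [NormedSpace ℝ E]
    (M : Type*) [TopologicalSpace M] [ChartedSpace E M] [IsManifold 𝓘(ℝ, E) ∞ M] where
  /-- the bilinear form on each tangent space -/
  form : (x : M) → TangentSpace 𝓘(ℝ, E) x →ₗ[ℝ] TangentSpace 𝓘(ℝ, E) x →ₗ[ℝ] ℝ
  symm : ∀ x v w, form x v w = form x w v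
  nondegenerate : ∀ x v, (∀ w, form x v w = 0) → v = 0
  smooth : ∀ X Y : VField E M, IsSmooth X → IsSmooth Y →
    ContMDiff 𝓘(ℝ, E) 𝓘(ℝ, ℝ) ∞ (fun x => form x (X x) (Y x))

/-- The function `g(X,Y)`. -/
noncomputable def Metric.eval (g : Metric E M) (X Y : VField E M) : M → ℝ :=
  fun x => g.form x (X x) (Y x)

/-- The covariant derivative `(∇_X g)(Y,Z)` of the metric. -/
noncomputable def derivMetric (C : Connection E M) (g : Metric E M) (X Y Z : VField E M) : M → ℝ :=
  fun x => dirDeriv X (g.eval Y Z) x - g.eval (nabla C X Y) Z x - g.eval Y (nabla C X Z) x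

variable [FiniteDimensional ℝ E] [CompleteSpace E]

/-- `D` is the Levi-Civita connection of `g`. -/
def IsLeviCivita (g : Metric E M) (D : Connection E M) : Prop :=
  D.torsion = 0 ∧
    ∀ X Y Z : VField E M, IsSmooth X → IsSmooth Y → IsSmooth Z → derivMetric D g X Y Z = 0

/-- `(M, ∇, g)` is pseudo-Hessian: `∇` is torsionless and flat, and `∇g` is totally symmetric. -/
def IsPseudoHessian (C : Connection E M) (g : Metric E M) : Prop :=
  C.torsion = 0 ∧ IsFlat C ∧
    ∀ X Y Z : VField E M, IsSmooth X → IsSmooth Y → IsSmooth Z →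
      derivMetric C g X Y Z = derivMetric C g Y X Z

/-- The dual connection `∇' = 2D - ∇`. -/
noncomputable def dualConnection (C D : Connection E M) : Connection E M :=
  CovariantDerivative.affineCombination D C (fun _ => 2)

/-- The tensor `γ = D - ∇`; here `gamma C D x v w = γ_v w`, so that `gamma C D x v` is the
endomorphism `i_v γ` of the tangent space at `x`. -/
noncomputable def gamma (C D : Connection E M) (x : M) (v : TangentSpace 𝓘(ℝ, E) x) :
    TangentSpace 𝓘(ℝ, E) x →ₗ[ℝ] TangentSpace 𝓘(ℝ, E) x where
  toFun w := CovariantDerivative.difference D C x w v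
  map_add' w w' := by simp
  map_smul' c w := by simp

/-- The vector field `γ_X Y`. -/
noncomputable def gammaField (C D : Connection E M) (X Y : VField E M) : VField E M :=
  fun x => gamma C D x (X x) (Y x)

/-- The Hessian curvature `Q = ∇γ`, that is
`Q(X,Y)Z = ∇_X(γ_Y Z) - γ_{∇_X Y} Z - γ_Y (∇_X Z)`. -/
noncomputable def hessianCurvature (C D : Connection E M) (X Y Z : VField E M) : VField E M :=
  nabla C X (gammaField C D Y Z) - gammaField C D (nabla C X Y) Z
    - gammaField C D Y (nabla C X Z)

/-- The Hessian curvature vanishes identically. -/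
def HessianCurvatureVanishes (C D : Connection E M) : Prop :=
  ∀ X Y Z : VField E M, IsSmooth X → IsSmooth Y → IsSmooth Z → hessianCurvature C D X Y Z = 0

/-- The first Koszul form `α(X) = tr(i_X γ)`. -/
noncomputable def koszulOne (C D : Connection E M) (X : VField E M) : M → ℝ :=
  fun x => LinearMap.trace ℝ (TangentSpace 𝓘(ℝ, E) x) (gamma C D x (X x))

/-- The second Koszul form `β = ∇α`, that is `β(X,Y) = X(α(Y)) - α(∇_X Y)`. -/
noncomputable def koszulTwo (C D : Connection E M) (X Y : VField E M) : M → ℝ :=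
  fun x => dirDeriv X (koszulOne C D Y) x - koszulOne C D (nabla C X Y) x

end Manifold

/-! ## An openness criterion -/

lemma map_nhds_exp_apply {E : Type*} [NormedAddCommGroup E] [NormedSpace ℝ E]
    [CompleteSpace E] {V : Type*} [NormedAddCommGroup V] [NormedSpace ℝ V]
    [CompleteSpace V] {F : Type*} [NormedAddCommGroup F] [NormedSpace ℝ F] [CompleteSpace F]
    (L : F →L[ℝ] E →L[ℝ] E) (P : E →L[ℝ] V) (ν μ : E)
    (h : ∀ v : V, ∃ s : F, P (L s ν) = v) :
    Filter.map (fun s : F => P (NormedSpace.exp (L s) ν - μ)) (𝓝 0) = 𝓝 (P (ν - μ)) := by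
  have hexp : HasStrictFDerivAt (NormedSpace.exp : (E →L[ℝ] E) → (E →L[ℝ] E))
      (ContinuousLinearMap.id ℝ (E →L[ℝ] E)) (L 0) := by
    rw [map_zero]
    exact hasStrictFDerivAt_exp_zero
  have h0 : HasStrictFDerivAt (fun s : F => NormedSpace.exp (L s)) L 0 :=
    hexp.comp (0 : F) L.hasStrictFDerivAt
  have h1 : HasStrictFDerivAt (fun s : F => NormedSpace.exp (L s) ν - μ) (L.flip ν) 0 :=
    ((ContinuousLinearMap.apply ℝ E ν).hasStrictFDerivAt.comp (0 : F) h0).sub_const μ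
  have h2 : HasStrictFDerivAt (fun s : F => P (NormedSpace.exp (L s) ν - μ))
      (P ∘L L.flip ν) 0 :=
    P.hasStrictFDerivAt.comp (0 : F) h1
  have hsurj : (P ∘L L.flip ν).range = ⊤ := by
    rw [LinearMap.range_eq_top]
    exact h
  have hmap := HasStrictFDerivAt.map_nhds_eq_of_surj h2 hsurj
  rw [hmap]
  simp

/-! ## The dual of a commutative associative algebra and the orbits of `Φ` -/

section Algebra

/-- An auxiliary norm on the dual of a finite-dimensional space (all norms on it are equivalent, so
that topology and smooth structure do not depend on the choice): the supremum norm in the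
coordinates of a dual basis. -/
noncomputable instance instNormedAddCommGroupDual {A : Type*} [AddCommGroup A] [Module ℝ A]
    [FiniteDimensional ℝ A] : NormedAddCommGroup (Module.Dual ℝ A) :=
  NormedAddCommGroup.induced (Module.Dual ℝ A) (Fin (Module.finrank ℝ A) → ℝ)
    (Module.finBasis ℝ A).dualBasis.equivFun.toLinearMap
    (Module.finBasis ℝ A).dualBasis.equivFun.injective

noncomputable instance instNormedSpaceDual {A : Type*} [AddCommGroup A] [Module ℝ A]
    [FiniteDimensional ℝ A] : NormedSpace ℝ (Module.Dual ℝ A) :=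
  NormedSpace.induced ℝ (Module.Dual ℝ A) (Fin (Module.finrank ℝ A) → ℝ)
    (Module.finBasis ℝ A).dualBasis.equivFun.toLinearMap

variable {A : Type*} [NonUnitalCommRing A] [Module ℝ A] [IsScalarTower ℝ A A]
  [SMulCommClass ℝ A A] [FiniteDimensional ℝ A]

/-- The transpose `L_a^*` of the multiplication `L_a`. -/
noncomputable def coadj (a : A) : Module.Dual ℝ A →L[ℝ] Module.Dual ℝ A :=
  LinearMap.toContinuousLinearMap (LinearMap.mulLeft ℝ a).dualMap

/-- The action `Φ(a,μ) = exp(L_a^*)(μ)`. -/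
noncomputable def action (a : A) (μ : Module.Dual ℝ A) : Module.Dual ℝ A :=
  NormedSpace.exp (coadj a) μ

/-- The symmetric bivector field `h` on the dual: `h(a,b)(ν) = ⟨ν, ab⟩`. -/
def bivector (ν : Module.Dual ℝ A) (a b : A) : ℝ := ν (a * b)

/-- The map `h_#` at `ν`, given by `⟨h_#(a), b⟩ = h(a,b)`. The vector field `X_a` on the dual is
`ν ↦ sharp ν a`. -/
def sharp (ν : Module.Dual ℝ A) : A →ₗ[ℝ] Module.Dual ℝ A where
  toFun a :=
    { toFun := fun b => bivector ν a b
      map_add' := fun b c => by simp [bivector, mul_add]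
      map_smul' := fun r b => by simp [bivector, mul_smul_comm] }
  map_add' a b := by ext c; simp [bivector, add_mul]
  map_smul' r a := by ext c; simp [bivector, smul_mul_assoc]

/-- The orbit of `μ` under `Φ`. -/
def Orbit (μ : Module.Dual ℝ A) : Type _ :=
  {ν : Module.Dual ℝ A // ∃ a : A, action a μ = ν}

instance (μ : Module.Dual ℝ A) : TopologicalSpace (Orbit μ) :=
  inferInstanceAs (TopologicalSpace {ν : Module.Dual ℝ A // ∃ a : A, action a μ = ν})

/-- The inclusion of the orbit into the dual. -/
def incl (μ : Module.Dual ℝ A) (ν : Orbit μ) : Module.Dual ℝ A := ν.1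

/-- The space `{X_a(μ)}`, the direction of the affine subspace in which the orbit is open. -/
abbrev tangentDir (μ : Module.Dual ℝ A) : Submodule ℝ (Module.Dual ℝ A) :=
  LinearMap.range (sharp μ)

lemma coadj_apply (a : A) (ν : Module.Dual ℝ A) (b : A) : coadj a ν b = ν (a * b) := rfl

lemma sharp_apply (ν : Module.Dual ℝ A) (a b : A) : sharp ν a b = ν (a * b) := rfl

lemma coadj_mem (a : A) {μ ν : Module.Dual ℝ A} (h : ν ∈ tangentDir μ) :
    coadj a ν ∈ tangentDir μ := by
  obtain ⟨b, rfl⟩ := h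
  refine ⟨b * a, ?_⟩
  ext c
  simp [coadj_apply, sharp_apply, mul_assoc]

lemma action_sub_mem (a : A) (μ : Module.Dual ℝ A) : action a μ - μ ∈ tangentDir μ := by
  have hs := NormedSpace.exp_series_hasSum_exp' (𝕂 := ℝ) (coadj a)
  have hs2 : HasSum (fun n : ℕ => ((n.factorial : ℝ)⁻¹ • (coadj a) ^ n) μ) (action a μ) :=
    hs.mapL (ContinuousLinearMap.apply ℝ (Module.Dual ℝ A) μ)
  have hs3 := (hasSum_nat_add_iff' 1).mpr hs2
  simp only [Finset.range_one, Finset.sum_singleton, Nat.factorial_zero, Nat.cast_one, inv_one,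
    pow_zero, one_smul, one_apply_eq_self] at hs3
  have hp : ∀ n : ℕ, ((coadj a) ^ (n + 1)) μ ∈ tangentDir μ := by
    intro n
    induction n with
    | zero => exact ⟨a, by ext c; simp [coadj_apply, sharp_apply]⟩
    | succ k ih =>
      rw [pow_succ']
      exact coadj_mem a ih
  have hc : IsClosed (tangentDir μ : Set (Module.Dual ℝ A)) :=
    Submodule.closed_of_finiteDimensional _
  refine hc.mem_of_tendsto hs3 (Filter.Eventually.of_forall fun s => ?_)
  exact Submodule.sum_mem _ fun n _ => Submodule.smul_mem _ _ (hp n)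

lemma coadj_comm (a b : A) : Commute (coadj a) (coadj b) := by
  ext ν c
  change coadj a (coadj b ν) c = coadj b (coadj a ν) c
  simp only [coadj_apply]
  rw [mul_left_comm]

lemma coadj_add (a b : A) : coadj (a + b) = coadj a + coadj b := by
  ext ν c
  change ν ((a + b) * c) = ν (a * c) + ν (b * c)
  rw [add_mul, map_add]

lemma action_add (a b : A) (μ : Module.Dual ℝ A) : action (a + b) μ = action a (action b μ) := by
  let _ : NormedAlgebra ℚ (Module.Dual ℝ A →L[ℝ] Module.Dual ℝ A) := .restrictScalars ℚ ℝ _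
  simp only [action, coadj_add]
  rw [NormedSpace.exp_add_of_commute (coadj_comm a b)]
  rfl

lemma action_zero (μ : Module.Dual ℝ A) : action 0 μ = μ := by
  have : coadj (0 : A) = 0 := by
    ext ν c
    change ν (0 * c) = 0
    simp
  simp [action, this]

lemma tangentDir_action_le (a : A) (μ : Module.Dual ℝ A) :
    tangentDir (action a μ) ≤ tangentDir μ := by
  rintro _ ⟨b, rfl⟩
  have h1 : sharp (action a μ) b = sharp μ b + coadj b (action a μ - μ) := by
    ext c
    simp [coadj_apply, sharp_apply]
  rw [h1]
  exact add_mem ⟨b, rfl⟩ (coadj_mem b (action_sub_mem a μ))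

/-- The tangent spaces of an orbit all coincide as subspaces of the dual. -/
lemma tangentDir_action (a : A) (μ : Module.Dual ℝ A) :
    tangentDir (action a μ) = tangentDir μ := by
  refine le_antisymm (tangentDir_action_le a μ) ?_
  have h := tangentDir_action_le (-a) (action a μ)
  rwa [← action_add, neg_add_cancel, action_zero] at h

lemma sharp_mem (μ : Module.Dual ℝ A) (ν : Orbit μ) (a : A) : sharp ν.1 a ∈ tangentDir μ := by
  obtain ⟨ν, b, rfl⟩ := ν
  rw [← tangentDir_action b μ]
  exact ⟨a, rfl⟩

/-- The affine coordinate `ν ↦ ν - μ` on the orbit. -/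
noncomputable def chartMap (μ : Module.Dual ℝ A) (ν : Orbit μ) : tangentDir μ :=
  ⟨ν.1 - μ, by obtain ⟨ν, b, rfl⟩ := ν; exact action_sub_mem b μ⟩

/-- The linear map `a ↦ L_a^*`. -/
noncomputable def coadjLin (A : Type*) [NonUnitalCommRing A] [Module ℝ A] [IsScalarTower ℝ A A]
    [SMulCommClass ℝ A A] [FiniteDimensional ℝ A] :
    A →ₗ[ℝ] Module.Dual ℝ A →L[ℝ] Module.Dual ℝ A where
  toFun := coadj
  map_add' := coadj_add
  map_smul' r a := by
    ext ν c
    change ν (r • a * c) = r * ν (a * c)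
    simp [smul_mul_assoc]

lemma isOpen_range_chartMap (μ : Module.Dual ℝ A) : IsOpen (Set.range (chartMap μ)) := by
  rw [isOpen_iff_mem_nhds]
  rintro _ ⟨⟨ν, a, rfl⟩, rfl⟩
  obtain ⟨P, hP⟩ := LinearMap.exists_leftInverse_of_injective (tangentDir μ).subtype
    (Submodule.ker_subtype _)
  have hPc : ∀ v : tangentDir μ, P.toContinuousLinearMap v = v := fun v => LinearMap.congr_fun hP v
  let e := (Module.finBasis ℝ A).equivFun
  have hmap := map_nhds_exp_apply
    (coadjLin A ∘ₗ e.symm.toLinearMap).toContinuousLinearMap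
    P.toContinuousLinearMap (action a μ) μ (by
    intro v
    obtain ⟨b, hb⟩ : (v : Module.Dual ℝ A) ∈ tangentDir (action a μ) := by
      rw [tangentDir_action]; exact v.2
    refine ⟨e b, ?_⟩
    have h1 : (coadjLin A ∘ₗ e.symm.toLinearMap).toContinuousLinearMap (e b) = coadj b := by
      change coadj (e.symm (e b)) = coadj b
      rw [e.symm_apply_apply]
    have h2 : coadj b (action a μ) = v := by
      rw [← hb]; rfl
    rw [h1, h2, hPc])
  have h0 : P.toContinuousLinearMap (action a μ - μ) = chartMap μ ⟨action a μ, a, rfl⟩ :=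
    hPc ⟨_, action_sub_mem a μ⟩
  rw [← h0, ← hmap]
  refine Filter.mem_map.mpr (Filter.Eventually.of_forall ?_)
  intro s
  refine ⟨⟨action (e.symm s) (action a μ), e.symm s + a, action_add _ a μ⟩, ?_⟩
  have : action (e.symm s) (action a μ) - μ ∈ tangentDir μ := by
    rw [← action_add]; exact action_sub_mem _ _
  exact (hPc ⟨_, this⟩).symm

lemma isOpenEmbedding_chartMap (μ : Module.Dual ℝ A) :
    Topology.IsOpenEmbedding (chartMap μ) := by
  refine ⟨⟨⟨?_⟩, ?_⟩, isOpen_range_chartMap μ⟩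
  · have h1 : Topology.IsInducing
        (fun ν : {ν : Module.Dual ℝ A // ∃ a : A, action a μ = ν} => ν.1 - μ) :=
      (Homeomorph.subRight μ).isInducing.comp Topology.IsInducing.subtypeVal
    have h2 : Topology.IsInducing (Subtype.val ∘ chartMap μ) := h1
    exact (Topology.IsInducing.of_comp_iff Topology.IsInducing.subtypeVal).mp h2 |>.eq_induced
  · intro x y hxy
    have := congrArg Subtype.val hxy
    exact Subtype.ext (sub_left_injective this)

instance (μ : Module.Dual ℝ A) : Nonempty (Orbit μ) := ⟨⟨μ, 0, action_zero μ⟩⟩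

/-- The orbit as a manifold: it is open in the affine subspace `μ + tangentDir μ`, and the affine
coordinate `ν ↦ ν - μ` is its only chart. -/
noncomputable instance (μ : Module.Dual ℝ A) : ChartedSpace (tangentDir μ) (Orbit μ) :=
  (isOpenEmbedding_chartMap μ).singletonChartedSpace

instance (μ : Module.Dual ℝ A) :
    IsManifold 𝓘(ℝ, tangentDir μ) ∞ (Orbit μ) :=
  (isOpenEmbedding_chartMap μ).isManifold_singleton

/-- The differential of the inclusion of the orbit at `ν`. -/
noncomputable def dincl (μ : Module.Dual ℝ A) (ν : Orbit μ) :
    TangentSpace 𝓘(ℝ, tangentDir μ) ν →L[ℝ] Module.Dual ℝ A :=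
  mvfderiv 𝓘(ℝ, tangentDir μ) (incl μ) ν

/-- The vector field `X_a` on the orbit, in the affine coordinate. -/
noncomputable def fieldX (μ : Module.Dual ℝ A) (a : A) : VField (tangentDir μ) (Orbit μ) :=
  fun ν => (⟨sharp ν.1 a, sharp_mem μ ν a⟩ : tangentDir μ)

/-- The connection on the orbit is the restriction of the canonical affine connection of the
dual: `∇_v Y` is the derivative along `v` of `Y`, regarded as a map into the dual. -/
def IsInducedConnection (μ : Module.Dual ℝ A) (C : Connection (tangentDir μ) (Orbit μ)) : Prop :=
  ∀ Y : VField (tangentDir μ) (Orbit μ), IsSmooth Y → ∀ (ν : Orbit μ)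
    (v : TangentSpace 𝓘(ℝ, tangentDir μ) ν),
    dincl μ ν (C Y ν v) = mvfderiv 𝓘(ℝ, tangentDir μ) (fun x => dincl μ x (Y x)) ν v

/-- The metric on the orbit is `g(h_#(a), h_#(b)) = h(a,b)`. -/
def IsInducedMetric (μ : Module.Dual ℝ A) (g : Metric (tangentDir μ) (Orbit μ)) : Prop :=
  ∀ (ν : Orbit μ) (v w : TangentSpace 𝓘(ℝ, tangentDir μ) ν) (a b : A),
    dincl μ ν v = sharp (incl μ ν) a → dincl μ ν w = sharp (incl μ ν) b →
      g.form ν v w = bivector (incl μ ν) a b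

/-- `(∇, g)` is the structure that the orbit inherits from the dual, and `D` is the Levi-Civita
connection of `g`. -/
def IsOrbitGeometry (μ : Module.Dual ℝ A) (C : Connection (tangentDir μ) (Orbit μ))
    (g : Metric (tangentDir μ) (Orbit μ)) (D : Connection (tangentDir μ) (Orbit μ)) : Prop :=
  IsInducedConnection μ C ∧ IsInducedMetric μ g ∧ IsLeviCivita g D

/-- The endomorphism of `A ⧸ {c | ⟨ν, cb⟩ = 0 for all b}` induced by `L_a`. This quotient is
identified with the tangent space at `ν` of the orbit by `b ↦ X_b(ν)`, and the endomorphism then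
becomes `X_b(ν) ↦ X_{ab}(ν)`. -/
noncomputable def inducedMul (ν : Module.Dual ℝ A) (a : A) :
    (A ⧸ LinearMap.ker (sharp ν)) →ₗ[ℝ] (A ⧸ LinearMap.ker (sharp ν)) :=
  Submodule.mapQ _ _ (LinearMap.mulLeft ℝ a) (by
    intro c hc
    rw [LinearMap.mem_ker] at hc
    rw [Submodule.mem_comap, LinearMap.mem_ker]
    ext b
    have := LinearMap.congr_fun hc (a * b)
    rw [sharp_apply] at this
    rw [sharp_apply, LinearMap.mulLeft_apply, mul_comm a c, mul_assoc]
    exact this)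

end Algebra

end PseudoHessian

namespace PseudoHessian

/-! ### Calculus on a manifold all of whose preferred charts coincide -/

section SingleChart

variable {E : Type*} [NormedAddCommGroup E] [NormedSpace ℝ E]
  {M : Type*} [TopologicalSpace M] [ChartedSpace E M] {e : OpenPartialHomeomorph M E}
  {F : Type*} [NormedAddCommGroup F] [NormedSpace ℝ F]

/-! Put `T = tangentDir μ`. The orbit is open in `μ + T`, so `u = ν - μ` is a global coordinate in
which `∇` is the ordinary derivative. The map `a ↦ [a] = X_a(μ)` identifies `A / A_μ` with `T`, and
`T` thereby becomes a commutative associative algebra with the nondegenerate invariant form `⟨[a],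
[b]⟩ = μ(ab)` (`orbitData`). With a formal unit `1`, the basic identity is `X_a(ν) = (1 + u)[a]`
(`shift_orbitChart_toDir`). All tangent spaces of the orbit equal `T`, so `1 + u` acts invertibly on
`T` (`isUnit_shift_orbitChart`), and the metric becomes `g_u(v, w) = ⟨(1 + u)⁻¹ v, w⟩`.

Multiplications commute with `(1 + u)⁻¹` and are self-adjoint, so every tensor is a product in `T`
times a power of `1 + u`. Thus `∇g = -⟨(1 + u)⁻² x y, z⟩` is totally symmetric, the Levi-Civita
connection has Christoffel symbols `γ_v w = -(1 + u)⁻¹ v w / 2`, and `Q(x, y)z = (1 + u)⁻² x y z /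
2`. Flatness of `g` holds because the curvature is an antisymmetrization of such symmetric products.
Substituting `(1 + u)[a]` for the arguments cancels the inverses and yields the formulas for the
`X_a`. In particular `γ_{X_a}` is the constant endomorphism `-[a]/2`, so the Koszul forms are traces
of multiplications. Finally `Q = 0` means that triple products vanish in `T`, that is, `μ(abcd) =
0`.

The data `∇, g, D` in the theorem are arbitrary ones satisfying the defining conditions. They are
reduced to the explicit model by `isInducedConnection_iff`, `IsInducedMetric.eq_orbitMetric` and the
uniqueness of the Levi-Civita connection (`IsLeviCivita.apply_eq`). -/

lemma mem_source_of_chartAt_eq (he : ∀ x : M, chartAt E x = e) (x : M) : x ∈ e.source := by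
  rw [← he x]; exact mem_chart_source E x

lemma apply_mem_target_of_chartAt_eq (he : ∀ x : M, chartAt E x = e) (x : M) : e x ∈ e.target :=
  e.map_source (mem_source_of_chartAt_eq he x)

lemma symm_apply_of_chartAt_eq (he : ∀ x : M, chartAt E x = e) (x : M) : e.symm (e x) = x :=
  e.left_inv (mem_source_of_chartAt_eq he x)

lemma mdifferentiableAt_iff_of_chartAt_eq (he : ∀ x : M, chartAt E x = e) {f : M → F} {x : M} :
    MDifferentiableAt 𝓘(ℝ, E) 𝓘(ℝ, F) f x ↔ DifferentiableAt ℝ (f ∘ e.symm) (e x) := by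
  rw [mdifferentiableAt_iff]
  simp only [writtenInExtChartAt, extChartAt, he, mfld_simps, differentiableWithinAt_univ]
  refine ⟨fun h => h.2, fun h => ⟨?_, h⟩⟩
  have h1 : ContinuousAt ((f ∘ e.symm) ∘ e) x :=
    h.continuousAt.comp (e.continuousAt (mem_source_of_chartAt_eq he x))
  refine h1.congr (Filter.Eventually.of_forall fun y => ?_)
  simp [symm_apply_of_chartAt_eq he]

lemma hasMFDerivAt_iff_of_chartAt_eq (he : ∀ x : M, chartAt E x = e) {f : M → F} {x : M}
    {f' : E →L[ℝ] F} :
    HasMFDerivAt 𝓘(ℝ, E) 𝓘(ℝ, F) f x f' ↔ HasFDerivAt (f ∘ e.symm) f' (e x) := by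
  have hd : writtenInExtChartAt 𝓘(ℝ, E) 𝓘(ℝ, F) x f = f ∘ e.symm := by
    ext u; simp [writtenInExtChartAt, extChartAt, he, chartAt_self_eq, mfld_simps]
  have hx : extChartAt 𝓘(ℝ, E) x x = e x := by simp [extChartAt, he]
  have h0 : HasMFDerivAt 𝓘(ℝ, E) 𝓘(ℝ, F) f x f' ↔ ContinuousAt f x ∧
      HasFDerivWithinAt (writtenInExtChartAt 𝓘(ℝ, E) 𝓘(ℝ, F) x f) f' (Set.range 𝓘(ℝ, E))
        (extChartAt 𝓘(ℝ, E) x x) := Iff.rfl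
  rw [h0, hd, hx, modelWithCornersSelf_coe, Set.range_id, hasFDerivWithinAt_univ]
  exact ⟨fun h => h.2, fun h => ⟨((mdifferentiableAt_iff_of_chartAt_eq he).2
    h.differentiableAt).continuousAt, h⟩⟩

lemma mvfderiv_eq_of_chartAt_eq (he : ∀ x : M, chartAt E x = e) {f : M → F} {x : M}
    (hf : DifferentiableAt ℝ (f ∘ e.symm) (e x)) (v : TangentSpace 𝓘(ℝ, E) x) :
    mvfderiv 𝓘(ℝ, E) f x v = fderiv ℝ (f ∘ e.symm) (e x) v := by
  have h := ((hasMFDerivAt_iff_of_chartAt_eq he).2 hf.hasFDerivAt).mfderiv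
  exact DFunLike.congr_fun h v

lemma contMDiff_iff_of_chartAt_eq [IsManifold 𝓘(ℝ, E) ∞ M] (he : ∀ x : M, chartAt E x = e)
    {f : M → F} :
    ContMDiff 𝓘(ℝ, E) 𝓘(ℝ, F) ∞ f ↔ ContDiffOn ℝ ∞ (f ∘ e.symm) e.target := by
  rcases isEmpty_or_nonempty M with hM | ⟨⟨x⟩⟩
  · refine ⟨fun _ u hu => (hM.false (e.symm u)).elim, fun _ x => (hM.false x).elim⟩
  have hs : e.source = Set.univ := Set.eq_univ_of_forall (mem_source_of_chartAt_eq he)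
  have := contMDiffOn_iff_of_subset_source (I := 𝓘(ℝ, E)) (I' := 𝓘(ℝ, F)) (n := ∞) (f := f)
    (s := Set.univ) (x := x) (y := f x) (by rw [he, hs]) (fun _ _ => by rw [chartAt_self_eq]; trivial)
  rw [← contMDiffOn_univ, this]
  simp only [extChartAt, he, mfld_simps, ← hs, e.image_source_eq_target]
  refine ⟨fun h => h.2, fun h => ⟨?_, h⟩⟩
  have h1 : ContinuousOn ((f ∘ e.symm) ∘ e) e.source :=
    h.continuousOn.comp e.continuousOn fun x hx => e.map_source hx
  exact h1.congr fun y _ => congrArg f (symm_apply_of_chartAt_eq he y).symm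

variable [IsManifold 𝓘(ℝ, E) ∞ M]

/-- With one chart, every tangent coordinate change is that of `e` with itself, hence trivial.
Sections of the tangent bundle may therefore be treated as `E`-valued functions. -/
lemma trivializationAt_snd_of_chartAt_eq (he : ∀ x : M, chartAt E x = e) (X : VField E M)
    (x y : M) : ((trivializationAt E (TangentSpace 𝓘(ℝ, E) : M → Type _) x)
      (⟨y, X y⟩ : TangentBundle 𝓘(ℝ, E) M)).2 = X y := by
  have : IsManifold 𝓘(ℝ, E) 1 M := .of_le (n := ∞) (by simp)
  have hy : y ∈ (extChartAt 𝓘(ℝ, E) y).source := mem_extChartAt_source y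
  refine Eq.trans ?_ (tangentCoordChange_self (I := 𝓘(ℝ, E)) (v := X y) hy)
  change tangentCoordChange 𝓘(ℝ, E) y x y (X y) = _
  simp only [tangentCoordChange_def, extChartAt, he]

/-- The expression of a vector field in a chart whose tangent coordinates are the standard ones. -/
def coordField (e : OpenPartialHomeomorph M E) (X : VField E M) : E → E := fun u => X (e.symm u)

lemma coordField_apply (he : ∀ x : M, chartAt E x = e) (X : VField E M) (x : M) :
    coordField e X (e x) = X x :=
  congrArg (fun y => (X y : E)) (symm_apply_of_chartAt_eq he x)

lemma isSmooth_iff_of_chartAt_eq (he : ∀ x : M, chartAt E x = e) {X : VField E M} :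
    IsSmooth X ↔ ContDiffOn ℝ ∞ (coordField e X) e.target := by
  refine Iff.trans ?_ (contMDiff_iff_of_chartAt_eq he (f := fun x => (X x : E)))
  refine forall_congr' fun x => ?_
  rw [Bundle.contMDiffAt_section]
  simp only [trivializationAt_snd_of_chartAt_eq he]

lemma mdifferentiableAt_section_iff_of_chartAt_eq (he : ∀ x : M, chartAt E x = e)
    {X : VField E M} {x : M} :
    MDifferentiableAt 𝓘(ℝ, E) 𝓘(ℝ, E).tangent
      (fun x => (⟨x, X x⟩ : TangentBundle 𝓘(ℝ, E) M)) x ↔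
      DifferentiableAt ℝ (coordField e X) (e x) := by
  refine Iff.trans ?_ (mdifferentiableAt_iff_of_chartAt_eq he (f := fun x => (X x : E)))
  refine (mdifferentiableAt_section (F := E) (E := (TangentSpace 𝓘(ℝ, E) : M → Type _))
    (IB := 𝓘(ℝ, E)) (fun x => X x)).trans ?_
  simp only [trivializationAt_snd_of_chartAt_eq he]

lemma differentiableAt_of_contDiffOn_target (he : ∀ x : M, chartAt E x = e) {f : E → F}
    (hf : ContDiffOn ℝ ∞ f e.target) (x : M) : DifferentiableAt ℝ f (e x) :=
  (hf.contDiffAt (e.open_target.mem_nhds (apply_mem_target_of_chartAt_eq he x))).differentiableAt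
    (by simp)

lemma hasMFDerivAt_chart (he : ∀ x : M, chartAt E x = e) (x : M) :
    HasMFDerivAt 𝓘(ℝ, E) 𝓘(ℝ, E) e x (ContinuousLinearMap.id ℝ E) := by
  rw [hasMFDerivAt_iff_of_chartAt_eq he]
  refine (hasFDerivAt_id _).congr_of_eventuallyEq ?_
  filter_upwards [e.open_target.mem_nhds (apply_mem_target_of_chartAt_eq he x)] with u hu
  simp [e.right_inv hu]

lemma hasMFDerivAt_chart_symm (he : ∀ x : M, chartAt E x = e) {u : E} (hu : u ∈ e.target) :
    HasMFDerivAt 𝓘(ℝ, E) 𝓘(ℝ, E) e.symm u (ContinuousLinearMap.id ℝ E) := by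
  have h0 : HasMFDerivAt 𝓘(ℝ, E) 𝓘(ℝ, E) e.symm u (ContinuousLinearMap.id ℝ E) ↔
      ContinuousAt e.symm u ∧
      HasFDerivWithinAt (writtenInExtChartAt 𝓘(ℝ, E) 𝓘(ℝ, E) u e.symm)
        (ContinuousLinearMap.id ℝ E) (Set.range 𝓘(ℝ, E)) (extChartAt 𝓘(ℝ, E) u u) := Iff.rfl
  rw [h0, modelWithCornersSelf_coe, Set.range_id, hasFDerivWithinAt_univ]
  refine ⟨e.symm.continuousAt hu, ?_⟩
  refine (hasFDerivAt_id _).congr_of_eventuallyEq ?_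
  have hu' : e.target ∈ 𝓝 (extChartAt 𝓘(ℝ, E) u u) := by
    simpa [chartAt_self_eq] using e.open_target.mem_nhds hu
  filter_upwards [hu'] with w hw
  simp [writtenInExtChartAt, extChartAt, he, e.right_inv hw, chartAt_self_eq]

/-- The bracket on `M` is the vector space bracket of the fields pulled back through the chart. The
chart and its inverse have identity differentials here, so the pullbacks are the coordinate fields
near `e x`. -/
lemma mlieBracket_eq_of_chartAt_eq (he : ∀ x : M, chartAt E x = e) (X Y : VField E M) (x : M) :
    (VectorField.mlieBracket 𝓘(ℝ, E) X Y x : E) =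
      fderiv ℝ (coordField e Y) (e x) (X x) - fderiv ℝ (coordField e X) (e x) (Y x) := by
  have key : ∀ Z : VField E M, (VectorField.mpullbackWithin 𝓘(ℝ, E) 𝓘(ℝ, E)
      (extChartAt 𝓘(ℝ, E) x).symm Z (Set.range 𝓘(ℝ, E)) : E → E) =ᶠ[𝓝 (e x)]
      coordField e Z := by
    intro Z
    filter_upwards [e.open_target.mem_nhds (apply_mem_target_of_chartAt_eq he x)] with u hu
    have h1 : ((extChartAt 𝓘(ℝ, E) x).symm : E → M) = e.symm := by ext w; simp [extChartAt, he]
    have h2 : mfderivWithin 𝓘(ℝ, E) 𝓘(ℝ, E) e.symm Set.univ u = ContinuousLinearMap.id ℝ E := by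
      rw [mfderivWithin_univ]; exact (hasMFDerivAt_chart_symm he hu).mfderiv
    rw [modelWithCornersSelf_coe, Set.range_id, h1, VectorField.mpullbackWithin_apply]
    refine (congrArg (fun L : E →L[ℝ] E => L.inverse (Z (e.symm u))) h2).trans ?_
    rw [ContinuousLinearMap.inverse_id]
    rfl
  have h1 : ((extChartAt 𝓘(ℝ, E) x) : M → E) = e := by ext w; simp [extChartAt, he]
  rw [← VectorField.mlieBracketWithin_univ, VectorField.mlieBracketWithin_apply,
    Set.preimage_univ, Set.univ_inter]
  have h2 : mfderiv 𝓘(ℝ, E) 𝓘(ℝ, E) (extChartAt 𝓘(ℝ, E) x) x = ContinuousLinearMap.id ℝ E := by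
    rw [h1]; exact (hasMFDerivAt_chart he x).mfderiv
  refine (congrArg (fun L : E →L[ℝ] E => L.inverse _) h2).trans ?_
  rw [ContinuousLinearMap.inverse_id, h1]
  have h3 := ((key X).lieBracket_vectorField_eq (𝕜 := ℝ) (key Y)).trans
    (congrFun VectorField.lieBracket_eq (e x))
  have h4 : (fderiv ℝ (coordField e Y) (e x)) (X x) - (fderiv ℝ (coordField e X) (e x)) (Y x) =
      (fderiv ℝ (coordField e Y) (e x)) (coordField e X (e x)) -
        (fderiv ℝ (coordField e X) (e x)) (coordField e Y (e x)) := by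
    rw [coordField_apply he, coordField_apply he]
  rw [modelWithCornersSelf_coe, Set.range_id]
  rw [modelWithCornersSelf_coe, Set.range_id] at h3
  exact (congrFun VectorField.lieBracketWithin_univ _).trans (h3.trans h4.symm)

end SingleChart
end PseudoHessian

namespace PseudoHessian

/-! ### Connections, curvature and metrics in a global chart -/

section Christoffel

variable {E : Type*} [NormedAddCommGroup E] [NormedSpace ℝ E]
  {M : Type*} [TopologicalSpace M] [ChartedSpace E M] [IsManifold 𝓘(ℝ, E) ∞ M]
  {e : OpenPartialHomeomorph M E}

/-- On smooth fields, the connection `D` has the Christoffel symbols `G` in the chart `e`: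
`∇_v Y` is the derivative of `Y` along `v` plus `G Y v`. -/
def HasChristoffel (e : OpenPartialHomeomorph M E) (D : Connection E M)
    (G : E → E →L[ℝ] E →L[ℝ] E) : Prop :=
  ∀ Y : VField E M, IsSmooth Y → ∀ (x : M) (v : E),
    (D Y x v : E) = fderiv ℝ (coordField e Y) (e x) v + G (e x) (Y x) v

lemma isSmooth_const (he : ∀ x : M, chartAt E x = e) (v : E) :
    IsSmooth (fun _ => v : VField E M) :=
  (isSmooth_iff_of_chartAt_eq he).2 contDiffOn_const

/-- The connection whose Christoffel symbols in a global chart vanish. -/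
noncomputable def chartConnection (he : ∀ x : M, chartAt E x = e) : Connection E M where
  toFun Y x := mvfderiv 𝓘(ℝ, E) (fun x => (Y x : E)) x
  isCovariantDerivativeOnUniv :=
    { add := by
        intro X Y x hX hY _
        have hX' := (mdifferentiableAt_iff_of_chartAt_eq he (f := fun x => (X x : E))).2
          ((mdifferentiableAt_section_iff_of_chartAt_eq he).1 hX)
        have hY' := (mdifferentiableAt_iff_of_chartAt_eq he (f := fun x => (Y x : E))).2
          ((mdifferentiableAt_section_iff_of_chartAt_eq he).1 hY)
        exact mvfderiv_add hX' hY'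
      leibniz := by
        intro X f x hX hf _
        have hX' := (mdifferentiableAt_iff_of_chartAt_eq he (f := fun x => (X x : E))).2
          ((mdifferentiableAt_section_iff_of_chartAt_eq he).1 hX)
        exact mvfderiv_smul hf hX' }

lemma chartConnection_apply (he : ∀ x : M, chartAt E x = e) {Y : VField E M} {x : M}
    (hY : DifferentiableAt ℝ (coordField e Y) (e x)) (v : E) :
    (chartConnection he Y x v : E) = fderiv ℝ (coordField e Y) (e x) v :=
  mvfderiv_eq_of_chartAt_eq he (f := fun x => (Y x : E)) hY v

/-- The connection with prescribed Christoffel symbols in a global chart. -/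
noncomputable def christoffelConnection (he : ∀ x : M, chartAt E x = e)
    (G : E → E →L[ℝ] E →L[ℝ] E) : Connection E M :=
  (chartConnection he).addOneForm (fun x => G (e x))

lemma christoffelConnection_apply (he : ∀ x : M, chartAt E x = e) (G : E → E →L[ℝ] E →L[ℝ] E)
    {Y : VField E M} {x : M} (hY : DifferentiableAt ℝ (coordField e Y) (e x)) (v : E) :
    (christoffelConnection he G Y x v : E) =
      fderiv ℝ (coordField e Y) (e x) v + G (e x) (Y x) v :=
  congrArg (fun w : E => w + G (e x) (Y x) v) (chartConnection_apply he hY v)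

lemma IsSmooth.differentiableAt_coordField (he : ∀ x : M, chartAt E x = e) {Y : VField E M}
    (hY : IsSmooth Y) (x : M) : DifferentiableAt ℝ (coordField e Y) (e x) :=
  differentiableAt_of_contDiffOn_target he ((isSmooth_iff_of_chartAt_eq he).1 hY) x

lemma IsSmooth.mdifferentiableAt (he : ∀ x : M, chartAt E x = e) {Y : VField E M}
    (hY : IsSmooth Y) (x : M) : MDifferentiableAt 𝓘(ℝ, E) 𝓘(ℝ, E).tangent
      (fun x => (⟨x, Y x⟩ : TangentBundle 𝓘(ℝ, E) M)) x :=
  (mdifferentiableAt_section_iff_of_chartAt_eq he).2 (hY.differentiableAt_coordField he x)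

lemma hasChristoffel_christoffelConnection (he : ∀ x : M, chartAt E x = e)
    (G : E → E →L[ℝ] E →L[ℝ] E) : HasChristoffel e (christoffelConnection he G) G :=
  fun _ hY x v => christoffelConnection_apply he G (hY.differentiableAt_coordField he x) v

lemma coordField_sub (X Y : VField E M) (u : E) :
    coordField e (X - Y) u = coordField e X u - coordField e Y u := rfl

lemma eq_of_coordField_eq (he : ∀ x : M, chartAt E x = e) {X Y : VField E M}
    (h : Set.EqOn (coordField e X) (coordField e Y) e.target) : X = Y := by
  funext x
  have h1 := h (apply_mem_target_of_chartAt_eq he x)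
  rwa [coordField_apply he, coordField_apply he] at h1

lemma HasChristoffel.coordField_nabla {D : Connection E M} {G : E → E →L[ℝ] E →L[ℝ] E}
    (hD : HasChristoffel e D G) {Y : VField E M} (hY : IsSmooth Y) (X : VField E M) {u : E}
    (hu : u ∈ e.target) :
    coordField e (nabla D X Y) u = fderiv ℝ (coordField e Y) u (coordField e X u)
      + G u (coordField e Y u) (coordField e X u) := by
  have h := hD Y hY (e.symm u) (X (e.symm u))
  rw [e.right_inv hu] at h
  exact h

lemma HasChristoffel.isSmooth_nabla (he : ∀ x : M, chartAt E x = e) {D : Connection E M}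
    {G : E → E →L[ℝ] E →L[ℝ] E} (hD : HasChristoffel e D G) (hG : ContDiffOn ℝ ∞ G e.target)
    {X Y : VField E M} (hX : IsSmooth X) (hY : IsSmooth Y) : IsSmooth (nabla D X Y) := by
  rw [isSmooth_iff_of_chartAt_eq he]
  have hx := (isSmooth_iff_of_chartAt_eq he).1 hX
  have hy := (isSmooth_iff_of_chartAt_eq he).1 hY
  exact (((hy.fderiv_of_isOpen e.open_target (by simp)).clm_apply hx).add
    ((hG.clm_apply hy).clm_apply hx)).congr fun _ => hD.coordField_nabla hY X

lemma _root_.ContDiffOn.differentiableAt_of_isOpen {F : Type*} [NormedAddCommGroup F]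
    [NormedSpace ℝ F] {f : E → F} {s : Set E} (hf : ContDiffOn ℝ ∞ f s) (hs : IsOpen s) {u : E}
    (hu : u ∈ s) : DifferentiableAt ℝ f u :=
  (hf.contDiffAt (hs.mem_nhds hu)).differentiableAt (by simp)

lemma fderiv_clm_apply_clm_apply {F₁ F₂ F₃ : Type*} [NormedAddCommGroup F₁] [NormedSpace ℝ F₁]
    [NormedAddCommGroup F₂] [NormedSpace ℝ F₂] [NormedAddCommGroup F₃] [NormedSpace ℝ F₃]
    {G : E → F₁ →L[ℝ] F₂ →L[ℝ] F₃} {y : E → F₁} {z : E → F₂} {u : E}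
    (hG : DifferentiableAt ℝ G u) (hy : DifferentiableAt ℝ y u) (hz : DifferentiableAt ℝ z u)
    (v : E) : fderiv ℝ (fun u => G u (y u) (z u)) u v =
      fderiv ℝ G u v (y u) (z u) + G u (fderiv ℝ y u v) (z u) + G u (y u) (fderiv ℝ z u v) := by
  rw [((hG.hasFDerivAt.clm_apply hy.hasFDerivAt).clm_apply hz.hasFDerivAt).fderiv]
  simp only [add_apply, ContinuousLinearMap.comp_apply, ContinuousLinearMap.flip_apply]
  abel

lemma HasChristoffel.fderiv_coordField_nabla (he : ∀ x : M, chartAt E x = e)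
    {D : Connection E M} {G : E → E →L[ℝ] E →L[ℝ] E} (hD : HasChristoffel e D G)
    (hG : ContDiffOn ℝ ∞ G e.target) {X Y : VField E M} (hX : IsSmooth X) (hY : IsSmooth Y)
    {u : E} (hu : u ∈ e.target) (v : E) :
    fderiv ℝ (coordField e (nabla D X Y)) u v =
      fderiv ℝ (fderiv ℝ (coordField e Y)) u v (coordField e X u) +
      fderiv ℝ (coordField e Y) u (fderiv ℝ (coordField e X) u v) +
      (fderiv ℝ G u v (coordField e Y u) (coordField e X u) +
        G u (fderiv ℝ (coordField e Y) u v) (coordField e X u) +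
        G u (coordField e Y u) (fderiv ℝ (coordField e X) u v)) := by
  have hxs := (isSmooth_iff_of_chartAt_eq he).1 hX
  have hys := (isSmooth_iff_of_chartAt_eq he).1 hY
  have hx := hxs.differentiableAt_of_isOpen e.open_target hu
  have hy := hys.differentiableAt_of_isOpen e.open_target hu
  have hy' := (hys.fderiv_of_isOpen e.open_target (m := ∞) (by simp)).differentiableAt_of_isOpen
    e.open_target hu
  have hg := hG.differentiableAt_of_isOpen e.open_target hu
  have hEq : Set.EqOn (coordField e (nabla D X Y)) _ e.target :=
    fun _ => hD.coordField_nabla hY X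
  have h1 := (hy'.hasFDerivAt.clm_apply hx.hasFDerivAt)
  rw [(hEq.eventuallyEq_of_mem (e.open_target.mem_nhds hu)).fderiv_eq,
    fderiv_fun_add h1.differentiableAt ((hg.clm_apply hy).clm_apply hx), add_apply,
    fderiv_clm_apply_clm_apply hg hy hx, h1.fderiv]
  simp only [add_apply, ContinuousLinearMap.comp_apply, ContinuousLinearMap.flip_apply]
  abel

lemma fderiv_fderiv_coordField_comm (he : ∀ x : M, chartAt E x = e) {Y : VField E M}
    (hY : IsSmooth Y) {u : E} (hu : u ∈ e.target) (v w : E) :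
    fderiv ℝ (fderiv ℝ (coordField e Y)) u v w =
      fderiv ℝ (fderiv ℝ (coordField e Y)) u w v := by
  have h : ContDiffAt ℝ ∞ (coordField e Y) u :=
    ((isSmooth_iff_of_chartAt_eq he).1 hY).contDiffAt (e.open_target.mem_nhds hu)
  exact ((h.of_le (m := 2) ENat.LEInfty.out).isSymmSndFDerivAt (by simp)).eq v w

lemma coordField_mlieBracket (he : ∀ x : M, chartAt E x = e) (X Y : VField E M) {u : E}
    (hu : u ∈ e.target) : coordField e (VectorField.mlieBracket 𝓘(ℝ, E) X Y) u =
      fderiv ℝ (coordField e Y) u (coordField e X u) -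
        fderiv ℝ (coordField e X) u (coordField e Y u) := by
  have h := mlieBracket_eq_of_chartAt_eq he X Y (e.symm u)
  rw [e.right_inv hu] at h
  exact h

/-- The curvature in terms of Christoffel symbols. -/
lemma HasChristoffel.coordField_curvature (he : ∀ x : M, chartAt E x = e)
    {D : Connection E M} {G : E → E →L[ℝ] E →L[ℝ] E} (hD : HasChristoffel e D G)
    (hG : ContDiffOn ℝ ∞ G e.target) {X Y Z : VField E M} (hX : IsSmooth X) (hY : IsSmooth Y)
    (hZ : IsSmooth Z) {u : E} (hu : u ∈ e.target) :
    coordField e (curvature D X Y Z) u =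
      fderiv ℝ G u (coordField e X u) (coordField e Z u) (coordField e Y u) -
        fderiv ℝ G u (coordField e Y u) (coordField e Z u) (coordField e X u) +
        G u (G u (coordField e Z u) (coordField e Y u)) (coordField e X u) -
        G u (G u (coordField e Z u) (coordField e X u)) (coordField e Y u) := by
  -- Second derivatives of `Z` cancel by symmetry, and the derivatives of `X` and `Y` cancel against
  -- the bracket term. The mixed terms `G (DZ X) Y + G (DZ Y) X` are symmetric in `X, Y`.
  rw [curvature, coordField_sub, coordField_sub,
    hD.coordField_nabla (hD.isSmooth_nabla he hG hY hZ) X hu,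
    hD.coordField_nabla (hD.isSmooth_nabla he hG hX hZ) Y hu,
    hD.coordField_nabla hZ _ hu, hD.fderiv_coordField_nabla he hG hY hZ hu,
    hD.fderiv_coordField_nabla he hG hX hZ hu, hD.coordField_nabla hZ _ hu,
    hD.coordField_nabla hZ _ hu, coordField_mlieBracket he X Y hu,
    fderiv_fderiv_coordField_comm he hZ hu (coordField e Y u)]
  simp only [map_add, map_sub, add_apply]
  abel

lemma HasChristoffel.isFlat_of_zero (he : ∀ x : M, chartAt E x = e) {C : Connection E M}
    (hC : HasChristoffel e C (fun _ => 0)) : IsFlat C := by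
  intro X Y Z hX hY hZ
  refine eq_of_coordField_eq he fun u hu => ?_
  rw [hC.coordField_curvature he contDiffOn_const hX hY hZ hu]
  simp
  rfl

/-- Symmetric Christoffel terms cancel and leave the bracket. Torsion is tested on fields that are
only differentiable at the point, whereas `HasChristoffel` speaks of smooth fields; hence the
restriction to `christoffelConnection`. -/
lemma torsion_christoffelConnection [FiniteDimensional ℝ E] [CompleteSpace E]
    (he : ∀ x : M, chartAt E x = e) {G : E → E →L[ℝ] E →L[ℝ] E} (hG : ∀ u v w, G u v w = G u w v) :
    (christoffelConnection he G).torsion = 0 := by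
  rw [CovariantDerivative.torsion_eq_zero_iff]
  intro X Y x hX hY
  have h1 := christoffelConnection_apply he G
    ((mdifferentiableAt_section_iff_of_chartAt_eq he).1 hY) (X x)
  have h2 := christoffelConnection_apply he G
    ((mdifferentiableAt_section_iff_of_chartAt_eq he).1 hX) (Y x)
  refine (congrArg₂ (fun a b : E => a - b) h1 h2).trans ?_
  rw [hG (e x) (Y x) (X x), add_sub_add_right_eq_sub]
  exact (mlieBracket_eq_of_chartAt_eq he X Y x).symm

lemma dirDeriv_eq_of_chartAt_eq (he : ∀ x : M, chartAt E x = e) {f : M → ℝ} {x : M}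
    (hf : DifferentiableAt ℝ (f ∘ e.symm) (e x)) (X : VField E M) :
    dirDeriv X f x = fderiv ℝ (f ∘ e.symm) (e x) (X x) :=
  mvfderiv_eq_of_chartAt_eq he hf (X x)

lemma HasChristoffel.derivMetric_symm_apply (he : ∀ x : M, chartAt E x = e)
    {D : Connection E M} {G : E → E →L[ℝ] E →L[ℝ] E} (hD : HasChristoffel e D G)
    {g : Metric E M} {H : E → E →L[ℝ] E →L[ℝ] ℝ}
    (hg : ∀ (x : M) (v w : E), g.form x v w = H (e x) v w)
    (hH : ContDiffOn ℝ ∞ H e.target) (X : VField E M) {Y Z : VField E M} (hY : IsSmooth Y)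
    (hZ : IsSmooth Z) {u : E} (hu : u ∈ e.target) :
    derivMetric D g X Y Z (e.symm u) =
      fderiv ℝ H u (coordField e X u) (coordField e Y u) (coordField e Z u) -
      H u (G u (coordField e Y u) (coordField e X u)) (coordField e Z u) -
      H u (coordField e Y u) (G u (coordField e Z u) (coordField e X u)) := by
  have hy := ((isSmooth_iff_of_chartAt_eq he).1 hY).differentiableAt_of_isOpen e.open_target hu
  have hz := ((isSmooth_iff_of_chartAt_eq he).1 hZ).differentiableAt_of_isOpen e.open_target hu
  have hh := hH.differentiableAt_of_isOpen e.open_target hu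
  have heval : ∀ (V W : VField E M) {u : E}, u ∈ e.target → g.eval V W (e.symm u) =
      H u (coordField e V u) (coordField e W u) := by
    intro V W u hu
    have h := hg (e.symm u) (V (e.symm u)) (W (e.symm u))
    rw [e.right_inv hu] at h
    exact h
  have h1 : Set.EqOn (g.eval Y Z ∘ e.symm)
      (fun u => H u (coordField e Y u) (coordField e Z u)) e.target := fun _ => heval Y Z
  have h2 := h1.eventuallyEq_of_mem (e.open_target.mem_nhds hu)
  have h3 : DifferentiableAt ℝ (g.eval Y Z ∘ e.symm) (e (e.symm u)) := by
    rw [e.right_inv hu]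
    exact ((hh.clm_apply hy).clm_apply hz).congr_of_eventuallyEq h2
  have h4 : dirDeriv X (g.eval Y Z) (e.symm u) =
      fderiv ℝ (g.eval Y Z ∘ e.symm) (e (e.symm u)) (coordField e X u) :=
    dirDeriv_eq_of_chartAt_eq he h3 X
  rw [derivMetric, h4, e.right_inv hu, h2.fderiv_eq, fderiv_clm_apply_clm_apply hh hy hz,
    heval _ _ hu, heval _ _ hu, hD.coordField_nabla hY X hu, hD.coordField_nabla hZ X hu]
  simp only [map_add, add_apply]
  ring

variable [FiniteDimensional ℝ E] [CompleteSpace E]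

lemma gammaField_apply (he : ∀ x : M, chartAt E x = e) (C D : Connection E M) (X : VField E M)
    {Y : VField E M} (hY : IsSmooth Y) (x : M) :
    gammaField C D X Y x = D Y x (X x) - C Y x (X x) := by
  have h := IsCovariantDerivativeOn.difference_apply D.isCovariantDerivativeOnUniv
    C.isCovariantDerivativeOnUniv (Set.mem_univ x) (hY.mdifferentiableAt he x)
  exact DFunLike.congr_fun h (X x)

/-- Since `γ` is tensorial, it can be tested on constant fields, whose derivatives vanish. -/
lemma gamma_apply (he : ∀ x : M, chartAt E x = e) {C D : Connection E M}
    {G : E → E →L[ℝ] E →L[ℝ] E} (hC : HasChristoffel e C (fun _ => 0))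
    (hD : HasChristoffel e D G) (x : M) (v w : E) : (gamma C D x v w : E) = G (e x) w v := by
  have hw := isSmooth_const he w
  refine (gammaField_apply he C D (fun _ => v) hw x).trans ?_
  refine (congrArg₂ (fun a b : E => a - b) (hD _ hw x v) (hC _ hw x v)).trans ?_
  simp

lemma coordField_gammaField (he : ∀ x : M, chartAt E x = e) {C D : Connection E M}
    {G : E → E →L[ℝ] E →L[ℝ] E} (hC : HasChristoffel e C (fun _ => 0))
    (hD : HasChristoffel e D G) (X Y : VField E M) {u : E} (hu : u ∈ e.target) :
    coordField e (gammaField C D X Y) u = G u (coordField e Y u) (coordField e X u) := by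
  have h := gamma_apply he hC hD (e.symm u) (X (e.symm u)) (Y (e.symm u))
  rw [e.right_inv hu] at h
  exact h

/-- In affine coordinates for `∇`, the Hessian curvature is the derivative of the Christoffel
symbols of `D`. -/
lemma coordField_hessianCurvature (he : ∀ x : M, chartAt E x = e) {C D : Connection E M}
    {G : E → E →L[ℝ] E →L[ℝ] E} (hC : HasChristoffel e C (fun _ => 0))
    (hD : HasChristoffel e D G) (hG : ContDiffOn ℝ ∞ G e.target) (X : VField E M)
    {Y Z : VField E M} (hY : IsSmooth Y) (hZ : IsSmooth Z) {u : E} (hu : u ∈ e.target) :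
    coordField e (hessianCurvature C D X Y Z) u =
      fderiv ℝ G u (coordField e X u) (coordField e Z u) (coordField e Y u) := by
  have hys := (isSmooth_iff_of_chartAt_eq he).1 hY
  have hzs := (isSmooth_iff_of_chartAt_eq he).1 hZ
  have hy := hys.differentiableAt_of_isOpen e.open_target hu
  have hz := hzs.differentiableAt_of_isOpen e.open_target hu
  have hg := hG.differentiableAt_of_isOpen e.open_target hu
  have hEq : Set.EqOn (coordField e (gammaField C D Y Z))
      (fun u => G u (coordField e Z u) (coordField e Y u)) e.target :=
    fun _ => coordField_gammaField he hC hD Y Z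
  have hs : IsSmooth (gammaField C D Y Z) := by
    rw [isSmooth_iff_of_chartAt_eq he]
    exact ((hG.clm_apply hzs).clm_apply hys).congr hEq
  rw [hessianCurvature, coordField_sub, coordField_sub, hC.coordField_nabla hs X hu,
    (hEq.eventuallyEq_of_mem (e.open_target.mem_nhds hu)).fderiv_eq,
    fderiv_clm_apply_clm_apply hg hz hy, coordField_gammaField he hC hD (nabla C X Y) Z hu,
    coordField_gammaField he hC hD Y (nabla C X Z) hu, hC.coordField_nabla hY X hu,
    hC.coordField_nabla hZ X hu]
  simp only [zero_apply, add_zero]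
  abel

/-- Uniqueness of the Levi-Civita connection. -/
lemma IsLeviCivita.apply_eq (he : ∀ x : M, chartAt E x = e) {g : Metric E M}
    {D D' : Connection E M} (hD : IsLeviCivita g D) (hD' : IsLeviCivita g D') {Y : VField E M}
    (hY : IsSmooth Y) (x : M) (v : TangentSpace 𝓘(ℝ, E) x) : D Y x v = D' Y x v := by
  have hgam : ∀ (X : VField E M) {Y : VField E M}, IsSmooth Y →
      gamma D' D x (X x) (Y x) = D Y x (X x) - D' Y x (X x) :=
    fun X _ hY => gammaField_apply he D' D X hY x
  -- Both connections are torsionless, so their antisymmetrizations are the same bracket and their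
  -- difference is symmetric.
  have hsymm : ∀ v w : TangentSpace 𝓘(ℝ, E) x, gamma D' D x v w = gamma D' D x w v := by
    intro v w
    have hv := isSmooth_const he (M := M) v
    have hw := isSmooth_const he (M := M) w
    have h1 := hgam (fun _ => v) hw
    have h2 := hgam (fun _ => w) hv
    have h3 := (CovariantDerivative.torsion_eq_zero_iff D).1 hD.1 (hv.mdifferentiableAt he x)
      (hw.mdifferentiableAt he x)
    have h4 := (CovariantDerivative.torsion_eq_zero_iff D').1 hD'.1 (hv.mdifferentiableAt he x)
      (hw.mdifferentiableAt he x)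
    have h5 := h3.trans h4.symm
    rw [sub_eq_sub_iff_sub_eq_sub] at h5
    exact h1.trans (h5.trans h2.symm)
  -- Both connections preserve `g`, so the derivative of `g(w, z)` drops out of the difference.
  have hskew : ∀ v w z : TangentSpace 𝓘(ℝ, E) x,
      g.form x (gamma D' D x v w) z + g.form x w (gamma D' D x v z) = 0 := by
    intro v w z
    have hv := isSmooth_const he (M := M) v
    have hw := isSmooth_const he (M := M) w
    have hz := isSmooth_const he (M := M) z
    have h1 := congrFun (hD.2 _ _ _ hv hw hz) x
    have h2 := congrFun (hD'.2 _ _ _ hv hw hz) x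
    have h3 := congrArg (fun a => g.form x a z) (hgam (fun _ => v) hw)
    have h4 := congrArg (fun a => g.form x w a) (hgam (fun _ => v) hz)
    simp only [derivMetric, Metric.eval, nabla, Pi.zero_apply] at h1 h2
    simp only [map_sub, LinearMap.sub_apply] at h3 h4
    linarith
  -- Koszul's argument: a trilinear form symmetric in its first two slots and skew in its last two
  -- vanishes.
  have hzero : ∀ v w : TangentSpace 𝓘(ℝ, E) x, gamma D' D x v w = 0 := by
    intro v w
    refine g.nondegenerate x _ fun z => ?_
    have h1 := hskew v w z
    have h2 := hskew w z v
    have h3 := hskew z v w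
    rw [g.symm x w, hsymm v z] at h1
    rw [g.symm x z, hsymm w v] at h2
    rw [g.symm x v, hsymm z w] at h3
    rw [g.symm x (gamma D' D x v w) z, g.symm x z] at *
    linarith
  have h := hgam (fun _ => (v : E)) hY
  rw [hzero] at h
  exact (sub_eq_zero.1 h.symm)

end Christoffel
end PseudoHessian

namespace PseudoHessian

/-! ### Algebras with an invariant form, and the operator `1 + u` -/

section InvariantForm

/-- A commutative associative multiplication on `E` with a nondegenerate invariant symmetric
bilinear form. -/
structure FrobeniusData (E : Type*) [NormedAddCommGroup E] [NormedSpace ℝ E] where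
  /-- the multiplication -/
  mul : E →L[ℝ] E →L[ℝ] E
  mul_comm : ∀ a b, mul a b = mul b a
  mul_assoc : ∀ a b c, mul (mul a b) c = mul a (mul b c)
  /-- the bilinear form -/
  form : E →L[ℝ] E →L[ℝ] ℝ
  form_symm : ∀ a b, form a b = form b a
  form_mul : ∀ a b c, form (mul a b) c = form a (mul b c)
  nondegenerate : ∀ a, (∀ b, form a b = 0) → a = 0

variable {E : Type*} [NormedAddCommGroup E] [NormedSpace ℝ E]

namespace FrobeniusData

variable (S : FrobeniusData E)

/-- Multiplication by `1 + u`, where `1` is a formal unit. -/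
noncomputable def shift (u : E) : E →L[ℝ] E := 1 + S.mul u

/-- Division by `1 + u`. -/
noncomputable def quot (u : E) : E →L[ℝ] E := Ring.inverse (S.shift u)

lemma shift_apply (u v : E) : S.shift u v = v + S.mul u v := rfl

variable {S} {u : E}

protected lemma mul_left_comm (a b c : E) : S.mul a (S.mul b c) = S.mul b (S.mul a c) := by
  rw [← S.mul_assoc, S.mul_comm a b, S.mul_assoc]

lemma mul_shift (a b : E) : S.mul a (S.shift u b) = S.shift u (S.mul a b) := by
  rw [shift_apply, shift_apply, map_add, FrobeniusData.mul_left_comm]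

lemma shift_mul (a b : E) : S.mul (S.shift u a) b = S.shift u (S.mul a b) := by
  rw [S.mul_comm, mul_shift, S.mul_comm]

/-- `Ring.inverse` is `0` at non-units, so everything about `quot` needs `hu`. -/
lemma shift_quot (hu : IsUnit (S.shift u)) (v : E) : S.shift u (S.quot u v) = v :=
  DFunLike.congr_fun (Ring.mul_inverse_cancel _ hu) v

lemma quot_shift (hu : IsUnit (S.shift u)) (v : E) : S.quot u (S.shift u v) = v :=
  DFunLike.congr_fun (Ring.inverse_mul_cancel _ hu) v

lemma mul_quot (hu : IsUnit (S.shift u)) (a b : E) :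
    S.mul a (S.quot u b) = S.quot u (S.mul a b) := by
  rw [← quot_shift hu (S.mul a (S.quot u b)), ← mul_shift, shift_quot hu]

lemma quot_mul (hu : IsUnit (S.shift u)) (a b : E) :
    S.mul (S.quot u a) b = S.quot u (S.mul a b) := by
  rw [S.mul_comm, mul_quot hu, S.mul_comm]

/-- Invariance makes multiplications self-adjoint, hence also `1 + u` and its inverse. This is what
makes the metric symmetric. -/
lemma form_shift (a b : E) : S.form (S.shift u a) b = S.form a (S.shift u b) := by
  rw [shift_apply, shift_apply, map_add, add_apply, map_add, S.mul_comm, S.form_mul]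

lemma form_quot (hu : IsUnit (S.shift u)) (a b : E) :
    S.form (S.quot u a) b = S.form a (S.quot u b) := by
  conv_lhs => rw [← shift_quot hu b]
  rw [← form_shift, shift_quot hu]

lemma form_mul_left (a b c : E) : S.form (S.mul a b) c = S.form b (S.mul a c) := by
  rw [S.mul_comm, S.form_mul]

variable (S)

/-- The Christoffel symbols `-(1 + u)⁻¹ v w / 2`. -/
noncomputable def christoffel (u : E) : E →L[ℝ] E →L[ℝ] E :=
  (-(1 / 2) : ℝ) • (ContinuousLinearMap.compL ℝ E E E (S.quot u)).comp S.mul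

/-- The bilinear form `⟨(1 + u)⁻¹ v, w⟩`. -/
noncomputable def metricForm (u : E) : E →L[ℝ] E →L[ℝ] ℝ := S.form.comp (S.quot u)

variable {S}

lemma christoffel_apply (u v w : E) :
    S.christoffel u v w = (-(1 / 2) : ℝ) • S.quot u (S.mul v w) := rfl

lemma metricForm_apply (u v w : E) : S.metricForm u v w = S.form (S.quot u v) w := rfl

lemma metricForm_comm (hu : IsUnit (S.shift u)) (v w : E) :
    S.metricForm u v w = S.metricForm u w v := by
  rw [metricForm_apply, metricForm_apply, form_quot hu, S.form_symm]

lemma christoffel_comm (u v w : E) : S.christoffel u v w = S.christoffel u w v := by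
  rw [christoffel_apply, christoffel_apply, S.mul_comm]

section Calculus

variable [CompleteSpace E]

lemma hasFDerivAt_shift (u : E) : HasFDerivAt S.shift S.mul u :=
  S.mul.hasFDerivAt.const_add 1

lemma contDiff_shift : ContDiff ℝ ∞ S.shift := contDiff_const.add S.mul.contDiff

/-- Chain rule: inversion has derivative `H ↦ -T⁻¹ H T⁻¹` at `T`, and `u ↦ 1 + u` has derivative
`S.mul`. -/
lemma fderiv_quot (hu : IsUnit (S.shift u)) (v w : E) :
    fderiv ℝ S.quot u v w = -S.quot u (S.mul v (S.quot u w)) := by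
  obtain ⟨T, hT⟩ := hu
  have h1 : HasFDerivAt Ring.inverse _ (S.shift u) :=
    hT ▸ hasFDerivAt_ringInverse (𝕜 := ℝ) (R := E →L[ℝ] E) T
  have h2 : HasFDerivAt S.quot _ u := h1.comp u (hasFDerivAt_shift u)
  have h3 : S.quot u = ↑T⁻¹ := by rw [quot, ← hT, Ring.inverse_unit]
  rw [h2.fderiv, h3]
  rfl

lemma contDiffAt_quot (hu : IsUnit (S.shift u)) : ContDiffAt ℝ ∞ S.quot u := by
  obtain ⟨T, hT⟩ := hu
  have h1 : ContDiffAt ℝ ∞ Ring.inverse (S.shift u) := hT ▸ contDiffAt_ringInverse ℝ T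
  exact h1.comp u contDiff_shift.contDiffAt

lemma differentiableAt_quot (hu : IsUnit (S.shift u)) : DifferentiableAt ℝ S.quot u :=
  (contDiffAt_quot hu).differentiableAt (by simp)

lemma contDiffAt_christoffel (hu : IsUnit (S.shift u)) : ContDiffAt ℝ ∞ S.christoffel u :=
  (((ContinuousLinearMap.compL ℝ E E E).contDiff.contDiffAt.comp u
    (contDiffAt_quot hu)).clm_comp contDiffAt_const).const_smul (-(1 / 2) : ℝ)

lemma contDiffAt_metricForm (hu : IsUnit (S.shift u)) : ContDiffAt ℝ ∞ S.metricForm u :=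
  contDiffAt_const.clm_comp (contDiffAt_quot hu)

lemma fderiv_christoffel (hu : IsUnit (S.shift u)) (x v w : E) :
    fderiv ℝ S.christoffel u x v w =
      (1 / 2 : ℝ) • S.quot u (S.mul x (S.quot u (S.mul v w))) := by
  -- The derivative of `u ↦ S.christoffel u v w` for fixed `v, w` is computed twice: by the product
  -- rule, and directly from the derivative of `quot`.
  have h1 := fderiv_clm_apply_clm_apply ((contDiffAt_christoffel hu).differentiableAt (by simp))
    (differentiableAt_const v) (differentiableAt_const w) x
  have h2 : HasFDerivAt (fun u => S.christoffel u v w) _ u :=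
    (((differentiableAt_quot hu).hasFDerivAt.clm_apply
      (hasFDerivAt_const (S.mul v w) u)).const_smul (-(1 / 2) : ℝ))
  rw [h2.fderiv] at h1
  simpa [fderiv_quot hu] using h1.symm

lemma fderiv_metricForm (hu : IsUnit (S.shift u)) (x v w : E) :
    fderiv ℝ S.metricForm u x v w = -S.form (S.quot u (S.mul x (S.quot u v))) w := by
  have h1 := fderiv_clm_apply_clm_apply ((contDiffAt_metricForm hu).differentiableAt (by simp))
    (differentiableAt_const v) (differentiableAt_const w) x
  have h2 : HasFDerivAt (fun u => S.metricForm u v w) _ u :=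
    ((S.form.flip w).hasFDerivAt.comp u ((differentiableAt_quot hu).hasFDerivAt.clm_apply
      (hasFDerivAt_const v u)))
  rw [h2.fderiv] at h1
  simpa [fderiv_quot hu] using h1.symm

end Calculus

end FrobeniusData

end InvariantForm

/-! ### The pseudo-Hessian geometry of `⟨(1 + u)⁻¹ v, w⟩` -/

section Geometry

open FrobeniusData

variable {E : Type*} [NormedAddCommGroup E] [NormedSpace ℝ E] [CompleteSpace E]
  {M : Type*} [TopologicalSpace M] [ChartedSpace E M] [IsManifold 𝓘(ℝ, E) ∞ M]
  {e : OpenPartialHomeomorph M E} {S : FrobeniusData E}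

/-- The metric `⟨(1 + u)⁻¹ v, w⟩` in the chart `e`. -/
noncomputable def FrobeniusData.metric (S : FrobeniusData E) (he : ∀ x : M, chartAt E x = e)
    (hS : ∀ u ∈ e.target, IsUnit (S.shift u)) : Metric E M where
  form x := ContinuousLinearMap.toLinearMap₁₂ (S.metricForm (e x))
  symm x v w := metricForm_comm (hS _ (apply_mem_target_of_chartAt_eq he x)) v w
  nondegenerate x v h := by
    have hu := hS _ (apply_mem_target_of_chartAt_eq he x)
    have h1 : S.quot (e x) v = 0 := S.nondegenerate _ h
    have h2 := shift_quot hu v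
    rw [h1, map_zero] at h2
    exact h2.symm
  smooth X Y hX hY := by
    rw [contMDiff_iff_of_chartAt_eq he]
    have hH : ContDiffOn ℝ ∞ S.metricForm e.target :=
      fun u hu => (contDiffAt_metricForm (hS u hu)).contDiffWithinAt
    refine ((hH.clm_apply ((isSmooth_iff_of_chartAt_eq he).1 hX)).clm_apply
      ((isSmooth_iff_of_chartAt_eq he).1 hY)).congr fun u hu => ?_
    change S.metricForm (e (e.symm u)) _ _ = _
    rw [e.right_inv hu]
    rfl

lemma FrobeniusData.metric_apply (he : ∀ x : M, chartAt E x = e)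
    (hS : ∀ u ∈ e.target, IsUnit (S.shift u)) (x : M) (v w : E) :
    (S.metric he hS).form x v w = S.metricForm (e x) v w := rfl

lemma FrobeniusData.contDiffOn_christoffel {s : Set E} (hS : ∀ u ∈ s, IsUnit (S.shift u)) :
    ContDiffOn ℝ ∞ S.christoffel s :=
  fun u hu => (contDiffAt_christoffel (hS u hu)).contDiffWithinAt

lemma FrobeniusData.contDiffOn_metricForm {s : Set E} (hS : ∀ u ∈ s, IsUnit (S.shift u)) :
    ContDiffOn ℝ ∞ S.metricForm s :=
  fun u hu => (contDiffAt_metricForm (hS u hu)).contDiffWithinAt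

/-- In the chart, `∇g` is the derivative of the metric coefficients, `-⟨(1 + u)⁻² x y, z⟩`, and `x y
= y x`. -/
lemma derivMetric_codazzi (he : ∀ x : M, chartAt E x = e)
    (hS : ∀ u ∈ e.target, IsUnit (S.shift u)) {C : Connection E M}
    (hC : HasChristoffel e C (fun _ => 0)) {X Y Z : VField E M} (hX : IsSmooth X)
    (hY : IsSmooth Y) (hZ : IsSmooth Z) :
    derivMetric C (S.metric he hS) X Y Z = derivMetric C (S.metric he hS) Y X Z := by
  funext x
  rw [← symm_apply_of_chartAt_eq he x]
  have hu := apply_mem_target_of_chartAt_eq he x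
  rw [hC.derivMetric_symm_apply he (metric_apply he hS) (contDiffOn_metricForm hS) X hY hZ hu,
    hC.derivMetric_symm_apply he (metric_apply he hS) (contDiffOn_metricForm hS) Y hX hZ hu]
  have hT := hS _ hu
  simp only [fderiv_metricForm hT, mul_quot hT, zero_apply, map_zero, sub_zero]
  rw [S.mul_comm]

/-- The metric coefficients contribute `-⟨(1 + u)⁻² x y, z⟩`, and each of the two Christoffel terms
gives back half of it. This is the origin of the coefficient `-1/2` in `christoffel`. -/
lemma derivMetric_christoffel_eq_zero (he : ∀ x : M, chartAt E x = e)
    (hS : ∀ u ∈ e.target, IsUnit (S.shift u)) {D : Connection E M}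
    (hD : HasChristoffel e D S.christoffel) (X : VField E M) {Y Z : VField E M}
    (hY : IsSmooth Y) (hZ : IsSmooth Z) : derivMetric D (S.metric he hS) X Y Z = 0 := by
  funext x
  rw [← symm_apply_of_chartAt_eq he x]
  have hu := apply_mem_target_of_chartAt_eq he x
  rw [hD.derivMetric_symm_apply he (metric_apply he hS) (contDiffOn_metricForm hS) X hY hZ hu]
  have hT := hS _ hu
  simp only [fderiv_metricForm hT, mul_quot hT, metricForm_apply, christoffel_apply, map_smul,
    smul_apply, form_quot hT, smul_eq_mul, Pi.zero_apply]
  rw [S.mul_comm (coordField e Z _), S.mul_comm (coordField e Y _), form_mul_left,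
    mul_quot hT, mul_quot hT]
  ring

/-- Every term of the curvature is a multiple of `(1 + u)⁻² x y z`, which is symmetric, so
exchanging `x` and `y` cancels the terms in pairs. -/
lemma isFlat_of_hasChristoffel (he : ∀ x : M, chartAt E x = e)
    (hS : ∀ u ∈ e.target, IsUnit (S.shift u)) {D : Connection E M}
    (hD : HasChristoffel e D S.christoffel) : IsFlat D := by
  intro X Y Z hX hY hZ
  refine eq_of_coordField_eq he fun u hu => ?_
  have hT := hS u hu
  rw [hD.coordField_curvature he (contDiffOn_christoffel hS) hX hY hZ hu]
  simp only [fderiv_christoffel hT, christoffel_apply, map_smul, smul_apply, mul_quot hT,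
    quot_mul hT]
  set x := coordField e X u
  set y := coordField e Y u
  set z := coordField e Z u
  have h1 : S.mul x (S.mul z y) = S.mul y (S.mul z x) := by
    rw [S.mul_comm z y, S.mul_comm z x, FrobeniusData.mul_left_comm]
  have h2 : S.mul (S.mul z y) x = S.mul (S.mul z x) y := by
    rw [S.mul_comm (S.mul z y) x, S.mul_comm (S.mul z x) y, h1]
  rw [h1, h2]
  refine Eq.trans (b := (0 : E)) ?_ rfl
  abel

variable [FiniteDimensional ℝ E]

lemma isLeviCivita_christoffelConnection (he : ∀ x : M, chartAt E x = e)
    (hS : ∀ u ∈ e.target, IsUnit (S.shift u)) :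
    IsLeviCivita (S.metric he hS) (christoffelConnection he S.christoffel) :=
  ⟨torsion_christoffelConnection he christoffel_comm, fun X _ _ _ hY hZ =>
    derivMetric_christoffel_eq_zero he hS (hasChristoffel_christoffelConnection he _) X hY hZ⟩

/-- By uniqueness, an arbitrary Levi-Civita connection agrees with the explicit one on smooth
fields. -/
lemma hasChristoffel_of_isLeviCivita (he : ∀ x : M, chartAt E x = e)
    (hS : ∀ u ∈ e.target, IsUnit (S.shift u)) {D : Connection E M}
    (hD : IsLeviCivita (S.metric he hS) D) : HasChristoffel e D S.christoffel := by
  intro Y hY x v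
  rw [hD.apply_eq he (isLeviCivita_christoffelConnection he hS) hY x v]
  exact hasChristoffel_christoffelConnection he _ Y hY x v

lemma isPseudoHessian_metric (he : ∀ x : M, chartAt E x = e)
    (hS : ∀ u ∈ e.target, IsUnit (S.shift u)) :
    IsPseudoHessian (christoffelConnection he fun _ => 0) (S.metric he hS) :=
  ⟨torsion_christoffelConnection he fun _ _ _ => rfl,
    (hasChristoffel_christoffelConnection he _).isFlat_of_zero he, fun _ _ _ hX hY hZ =>
      derivMetric_codazzi he hS (hasChristoffel_christoffelConnection he _) hX hY hZ⟩

/-- The field `v ↦ (1 + u) v`. -/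
noncomputable def FrobeniusData.field (S : FrobeniusData E) (e : OpenPartialHomeomorph M E)
    (a : E) : VField E M := fun x => S.shift (e x) a

lemma FrobeniusData.coordField_field (a : E) {u : E} (hu : u ∈ e.target) :
    coordField e (S.field e a) u = S.shift u a := by
  change S.shift (e (e.symm u)) a = _
  rw [e.right_inv hu]

lemma FrobeniusData.isSmooth_field (he : ∀ x : M, chartAt E x = e) (a : E) :
    IsSmooth (S.field e a) := by
  rw [isSmooth_iff_of_chartAt_eq he]
  exact ((contDiff_shift.clm_apply contDiff_const).contDiffOn).congr
    fun u hu => coordField_field a hu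

lemma fderiv_coordField_field (a : E) {u : E} (hu : u ∈ e.target) (v : E) :
    fderiv ℝ (coordField e (S.field e a)) u v = S.mul v a := by
  have hEq : Set.EqOn (coordField e (S.field e a)) (fun u => S.shift u a) e.target :=
    fun u hu => coordField_field a hu
  rw [(hEq.eventuallyEq_of_mem (e.open_target.mem_nhds hu)).fderiv_eq,
    ((hasFDerivAt_shift u).clm_apply (hasFDerivAt_const a u)).fderiv]
  simp

lemma coordField_smul (r : ℝ) (X : VField E M) (u : E) :
    coordField e (r • X) u = r • coordField e X u := rfl

/-- The derivative of `u ↦ (1 + u) b` in the direction `(1 + u) a` is `(1 + u) a b`. -/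
lemma nabla_field_of_zero (he : ∀ x : M, chartAt E x = e) {C : Connection E M}
    (hC : HasChristoffel e C (fun _ => 0)) (a b : E) :
    nabla C (S.field e a) (S.field e b) = S.field e (S.mul a b) := by
  refine eq_of_coordField_eq he fun u hu => ?_
  rw [hC.coordField_nabla (isSmooth_field he b) _ hu, fderiv_coordField_field b hu,
    coordField_field a hu, coordField_field _ hu, zero_apply, zero_apply, add_zero,
    shift_mul, coordField_field _ hu]

/-- The factor `1 + u` cancels the inverse, so `γ` contracted with the field of `a` no longer
depends on the point. -/
lemma christoffel_shift {u : E} (hu : IsUnit (S.shift u)) (a b : E) :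
    S.christoffel u (S.shift u a) b = (-(1 / 2) : ℝ) • S.mul a b := by
  rw [christoffel_apply, shift_mul, quot_shift hu]

lemma nabla_field (he : ∀ x : M, chartAt E x = e) (hS : ∀ u ∈ e.target, IsUnit (S.shift u))
    {D : Connection E M} (hD : HasChristoffel e D S.christoffel) (a b : E) :
    nabla D (S.field e a) (S.field e b) = (1 / 2 : ℝ) • S.field e (S.mul a b) := by
  refine eq_of_coordField_eq he fun u hu => ?_
  rw [hD.coordField_nabla (isSmooth_field he b) _ hu, fderiv_coordField_field b hu,
    coordField_field a hu, coordField_field b hu, christoffel_shift (hS u hu), coordField_smul,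
    coordField_field _ hu, shift_mul, mul_shift, S.mul_comm b a]
  module

lemma nabla_dualConnection_field (he : ∀ x : M, chartAt E x = e)
    (hS : ∀ u ∈ e.target, IsUnit (S.shift u)) {C D : Connection E M}
    (hC : HasChristoffel e C (fun _ => 0)) (hD : HasChristoffel e D S.christoffel) (a b : E) :
    nabla (dualConnection C D) (S.field e a) (S.field e b) = 0 := by
  have h : nabla (dualConnection C D) (S.field e a) (S.field e b) =
      (2 : ℝ) • nabla D (S.field e a) (S.field e b) +
        (1 - 2 : ℝ) • nabla C (S.field e a) (S.field e b) := rfl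
  rw [h, nabla_field he hS hD, nabla_field_of_zero he hC]
  module

/-- The three arguments supply `(1 + u)³` against `(1 + u)⁻²`, leaving one factor `1 + u`. -/
lemma hessianCurvature_field (he : ∀ x : M, chartAt E x = e)
    (hS : ∀ u ∈ e.target, IsUnit (S.shift u)) {C D : Connection E M}
    (hC : HasChristoffel e C (fun _ => 0)) (hD : HasChristoffel e D S.christoffel) (a b c : E) :
    hessianCurvature C D (S.field e a) (S.field e b) (S.field e c) =
      (1 / 2 : ℝ) • S.field e (S.mul (S.mul a b) c) := by
  refine eq_of_coordField_eq he fun u hu => ?_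
  rw [coordField_hessianCurvature he hC hD (contDiffOn_christoffel hS) _ (isSmooth_field he b)
    (isSmooth_field he c) hu, fderiv_christoffel (hS u hu), coordField_field a hu,
    coordField_field b hu, coordField_field c hu]
  rw [coordField_smul, coordField_field _ hu]
  simp only [shift_mul, mul_shift, quot_shift (hS u hu)]
  rw [S.mul_comm c b, S.mul_assoc]

lemma hessianCurvatureVanishes_iff (he : ∀ x : M, chartAt E x = e)
    (hS : ∀ u ∈ e.target, IsUnit (S.shift u)) {C D : Connection E M}
    (hC : HasChristoffel e C (fun _ => 0)) (hD : HasChristoffel e D S.christoffel) [Nonempty M] :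
    HessianCurvatureVanishes C D ↔ ∀ a b c : E, S.mul (S.mul a b) c = 0 := by
  refine ⟨fun h a b c => ?_, fun h X Y Z hX hY hZ => ?_⟩
  -- A single point suffices: there `Q` on the fields of `a, b, c` is `(1 + u) a b c / 2`, and `1 +
  -- u` is injective.
  · obtain ⟨x⟩ := ‹Nonempty M›
    have hu := apply_mem_target_of_chartAt_eq he x
    have h1 := h (S.field e a) (S.field e b) (S.field e c) (isSmooth_field he a)
      (isSmooth_field he b) (isSmooth_field he c)
    rw [hessianCurvature_field he hS hC hD, smul_eq_zero_iff_right (by norm_num)] at h1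
    have h2 := congrArg (fun X => coordField e X (e x)) h1
    have h3 : S.shift (e x) (S.mul (S.mul a b) c) = 0 := (coordField_field _ hu).symm.trans h2
    rw [← quot_shift (hS _ hu) (S.mul (S.mul a b) c), h3, map_zero]
  · refine eq_of_coordField_eq he fun u hu => ?_
    have hT := hS u hu
    rw [coordField_hessianCurvature he hC hD (contDiffOn_christoffel hS) _ hY hZ hu,
      fderiv_christoffel hT, mul_quot hT, ← S.mul_assoc, h, map_zero, map_zero, smul_zero]
    rfl

lemma gamma_field (he : ∀ x : M, chartAt E x = e) (hS : ∀ u ∈ e.target, IsUnit (S.shift u))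
    {C D : Connection E M} (hC : HasChristoffel e C (fun _ => 0))
    (hD : HasChristoffel e D S.christoffel) (a : E) (x : M) :
    gamma C D x (S.field e a x) = (-(1 / 2) : ℝ) • (S.mul a : E →ₗ[ℝ] E) := by
  refine LinearMap.ext fun w => ?_
  refine (gamma_apply he hC hD x (S.shift (e x) a) w).trans ?_
  exact (christoffel_comm (E := E) (S := S) _ _ _).trans
    (christoffel_shift (hS _ (apply_mem_target_of_chartAt_eq he x)) a w)

lemma koszulOne_field (he : ∀ x : M, chartAt E x = e) (hS : ∀ u ∈ e.target, IsUnit (S.shift u))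
    {C D : Connection E M} (hC : HasChristoffel e C (fun _ => 0))
    (hD : HasChristoffel e D S.christoffel) (a : E) (x : M) :
    koszulOne C D (S.field e a) x = -(1 / 2) * LinearMap.trace ℝ E (S.mul a) := by
  rw [koszulOne, gamma_field he hS hC hD]
  exact map_smul (LinearMap.trace ℝ E) _ _

/-- `α` is constant on the field of `b`, so only `-α(∇_X Y)` remains; hence the opposite sign. -/
lemma koszulTwo_field (he : ∀ x : M, chartAt E x = e) (hS : ∀ u ∈ e.target, IsUnit (S.shift u))
    {C D : Connection E M} (hC : HasChristoffel e C (fun _ => 0))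
    (hD : HasChristoffel e D S.christoffel) (a b : E) (x : M) :
    koszulTwo C D (S.field e a) (S.field e b) x =
      1 / 2 * LinearMap.trace ℝ E (S.mul (S.mul a b)) := by
  have h : koszulOne C D (S.field e b) = fun _ => -(1 / 2) * LinearMap.trace ℝ E (S.mul b) :=
    funext fun x => koszulOne_field he hS hC hD b x
  rw [koszulTwo, nabla_field_of_zero he hC, koszulOne_field he hS hC hD, h, dirDeriv,
    mvfderiv_const]
  simp

end Geometry
end PseudoHessian

namespace PseudoHessian

/-! ### The orbit as an instance of this geometry -/

section OrbitGeometry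

open FrobeniusData (shift_apply quot_shift mul_shift)

variable {A : Type*} [NonUnitalCommRing A] [Module ℝ A] [IsScalarTower ℝ A A]
  [SMulCommClass ℝ A A] [FiniteDimensional ℝ A] (μ : Module.Dual ℝ A)

/-- The projection of the algebra to `tangentDir μ`. -/
noncomputable def toDir : A →ₗ[ℝ] tangentDir μ := (sharp μ).rangeRestrict

lemma toDir_surjective : Function.Surjective (toDir μ) := LinearMap.surjective_rangeRestrict _

lemma coe_toDir_apply (a b : A) : (toDir μ a : Module.Dual ℝ A) b = μ (a * b) := rfl

/-- A linear section of `toDir`. -/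
noncomputable def dirSection : tangentDir μ →ₗ[ℝ] A :=
  ((toDir μ).exists_rightInverse_of_surjective
    (LinearMap.range_eq_top.2 (toDir_surjective μ))).choose

lemma toDir_dirSection (v : tangentDir μ) : toDir μ (dirSection μ v) = v :=
  LinearMap.congr_fun ((toDir μ).exists_rightInverse_of_surjective
    (LinearMap.range_eq_top.2 (toDir_surjective μ))).choose_spec v

/-- Changing the representative adds an element of the ideal `A_μ`, which `μ(· c)` does not see.
This makes the product and the form below independent of the section. -/
lemma apply_dirSection_toDir_mul (a c : A) :
    μ (dirSection μ (toDir μ a) * c) = μ (a * c) := by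
  rw [← coe_toDir_apply, toDir_dirSection, coe_toDir_apply]

/-- The multiplication that `toDir` induces on `tangentDir μ`. -/
noncomputable def dirMul : tangentDir μ →L[ℝ] tangentDir μ →L[ℝ] tangentDir μ :=
  LinearMap.toContinuousBilinearMap
    (((LinearMap.mul ℝ A).compl₁₂ (dirSection μ) (dirSection μ)).compr₂ (toDir μ))

lemma dirMul_toDir (a b : A) : dirMul μ (toDir μ a) (toDir μ b) = toDir μ (a * b) := by
  ext c
  change μ (dirSection μ (toDir μ a) * dirSection μ (toDir μ b) * c) = μ (a * b * c)
  rw [mul_assoc, apply_dirSection_toDir_mul, mul_left_comm, apply_dirSection_toDir_mul,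
    mul_left_comm, mul_assoc]

/-- The bilinear form that `toDir` induces on `tangentDir μ` from `h` at `μ`. -/
noncomputable def dirForm : tangentDir μ →L[ℝ] tangentDir μ →L[ℝ] ℝ :=
  LinearMap.toContinuousBilinearMap
    (((LinearMap.mul ℝ A).compl₁₂ (dirSection μ) (dirSection μ)).compr₂ μ)

lemma dirForm_toDir (a b : A) : dirForm μ (toDir μ a) (toDir μ b) = μ (a * b) := by
  change μ (dirSection μ (toDir μ a) * dirSection μ (toDir μ b)) = μ (a * b)
  rw [apply_dirSection_toDir_mul, mul_comm, apply_dirSection_toDir_mul, mul_comm]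

/-- The multiplication and the invariant form on `tangentDir μ`. -/
noncomputable def orbitData : FrobeniusData (tangentDir μ) where
  mul := dirMul μ
  mul_comm a b := by
    obtain ⟨a, rfl⟩ := toDir_surjective μ a
    obtain ⟨b, rfl⟩ := toDir_surjective μ b
    rw [dirMul_toDir, dirMul_toDir, mul_comm]
  mul_assoc a b c := by
    obtain ⟨a, rfl⟩ := toDir_surjective μ a
    obtain ⟨b, rfl⟩ := toDir_surjective μ b
    obtain ⟨c, rfl⟩ := toDir_surjective μ c
    simp only [dirMul_toDir, mul_assoc]
  form := dirForm μ
  form_symm a b := by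
    obtain ⟨a, rfl⟩ := toDir_surjective μ a
    obtain ⟨b, rfl⟩ := toDir_surjective μ b
    rw [dirForm_toDir, dirForm_toDir, mul_comm]
  form_mul a b c := by
    obtain ⟨a, rfl⟩ := toDir_surjective μ a
    obtain ⟨b, rfl⟩ := toDir_surjective μ b
    obtain ⟨c, rfl⟩ := toDir_surjective μ c
    simp only [dirMul_toDir, dirForm_toDir, mul_assoc]
  nondegenerate a h := by
    obtain ⟨a, rfl⟩ := toDir_surjective μ a
    ext b
    rw [coe_toDir_apply, ← dirForm_toDir, h]
    rfl

lemma orbitData_mul_toDir (a b : A) :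
    (orbitData μ).mul (toDir μ a) (toDir μ b) = toDir μ (a * b) := dirMul_toDir μ a b

/-- For `w = [b]`, both sides are `μ(ab)`. The form is thus the restricted evaluation pairing of `A`
with its dual. -/
lemma orbitData_form_toDir (a : A) (w : tangentDir μ) :
    (orbitData μ).form (toDir μ a) w = (w : Module.Dual ℝ A) a := by
  obtain ⟨b, rfl⟩ := toDir_surjective μ w
  rw [coe_toDir_apply, mul_comm]
  exact dirForm_toDir μ a b

/-- The affine chart of the orbit. -/
noncomputable def orbitChart : OpenPartialHomeomorph (Orbit μ) (tangentDir μ) :=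
  (isOpenEmbedding_chartMap μ).toOpenPartialHomeomorph

lemma chartAt_orbit (ν : Orbit μ) : chartAt (tangentDir μ) ν = orbitChart μ := rfl

lemma coe_orbitChart_apply (ν : Orbit μ) :
    (orbitChart μ ν : Module.Dual ℝ A) = incl μ ν - μ := rfl

/-- The bridge to the abstract model: writing `ν = μ + [c]`, associativity gives `X_a(ν) = [a] +
[ca]`. -/
lemma shift_orbitChart_toDir (ν : Orbit μ) (a : A) :
    ((orbitData μ).shift (orbitChart μ ν) (toDir μ a) : Module.Dual ℝ A) =
      sharp (incl μ ν) a := by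
  obtain ⟨c, hc⟩ := toDir_surjective μ (orbitChart μ ν)
  have h1 : incl μ ν = μ + toDir μ c := by rw [hc, coe_orbitChart_apply]; abel
  rw [shift_apply, ← hc, orbitData_mul_toDir, h1]
  ext b
  change μ (a * b) + μ (c * a * b) = μ (a * b) + μ (c * (a * b))
  rw [mul_assoc]

lemma tangentDir_incl (ν : Orbit μ) : tangentDir (incl μ ν) = tangentDir μ := by
  obtain ⟨ν, b, rfl⟩ := ν
  exact tangentDir_action b μ

/-- The range of `1 + u` is `{X_a(ν)}`, which equals `{X_a(μ)} = T` along the orbit; in finite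
dimension surjectivity is enough. -/
lemma isUnit_shift_orbitChart (ν : Orbit μ) : IsUnit ((orbitData μ).shift (orbitChart μ ν)) := by
  have hs : Function.Surjective ((orbitData μ).shift (orbitChart μ ν)) := by
    intro v
    have hv : (v : Module.Dual ℝ A) ∈ tangentDir (incl μ ν) := by
      rw [tangentDir_incl]; exact v.2
    obtain ⟨a, ha⟩ := hv
    exact ⟨toDir μ a, Subtype.ext ((shift_orbitChart_toDir μ ν a).trans ha)⟩
  rw [ContinuousLinearMap.isUnit_iff_bijective]
  exact ⟨LinearMap.injective_iff_surjective
    (f := ((orbitData μ).shift (orbitChart μ ν)).toLinearMap).2 hs, hs⟩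

lemma isUnit_shift_of_mem_target :
    ∀ u ∈ (orbitChart μ).target, IsUnit ((orbitData μ).shift u) := by
  intro u hu
  rw [← (orbitChart μ).right_inv hu]
  exact isUnit_shift_orbitChart μ _

lemma fieldX_eq (a : A) : fieldX μ a = (orbitData μ).field (orbitChart μ) (toDir μ a) :=
  funext fun ν => Subtype.ext (shift_orbitChart_toDir μ ν a).symm

lemma incl_comp_orbitChart_symm :
    Set.EqOn (incl μ ∘ (orbitChart μ).symm) (fun u => (tangentDir μ).subtypeL u + μ)
      (orbitChart μ).target := by
  intro u hu
  have h := coe_orbitChart_apply μ ((orbitChart μ).symm u)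
  rw [(orbitChart μ).right_inv hu] at h
  change incl μ ((orbitChart μ).symm u) = u + μ
  rw [h]
  abel

lemma contMDiff_incl :
    ContMDiff 𝓘(ℝ, tangentDir μ) 𝓘(ℝ, Module.Dual ℝ A) ∞ (incl μ) := by
  rw [contMDiff_iff_of_chartAt_eq (chartAt_orbit μ)]
  exact (((tangentDir μ).subtypeL.contDiff.add contDiff_const).contDiffOn).congr
    (incl_comp_orbitChart_symm μ)

lemma dincl_apply (ν : Orbit μ) (v : tangentDir μ) : dincl μ ν v = (v : Module.Dual ℝ A) := by
  have hν := apply_mem_target_of_chartAt_eq (chartAt_orbit μ) ν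
  have h1 : HasFDerivAt (fun u : tangentDir μ => (tangentDir μ).subtypeL u + μ)
      (tangentDir μ).subtypeL (orbitChart μ ν) := (tangentDir μ).subtypeL.hasFDerivAt.add_const μ
  have h2 := h1.congr_of_eventuallyEq ((incl_comp_orbitChart_symm μ).eventuallyEq_of_mem
    ((orbitChart μ).open_target.mem_nhds hν))
  refine (mvfderiv_eq_of_chartAt_eq (chartAt_orbit μ) h2.differentiableAt v).trans ?_
  rw [h2.fderiv]
  rfl

lemma dincl_fieldX (ν : Orbit μ) (a : A) :
    dincl μ ν (fieldX μ a ν) = sharp (incl μ ν) a := dincl_apply μ ν _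

lemma dincl_injective (ν : Orbit μ) : Function.Injective (dincl μ ν) := by
  intro v w h
  exact Subtype.ext ((dincl_apply μ ν v).symm.trans (h.trans (dincl_apply μ ν w)))

lemma exists_eq_fieldX (ν : Orbit μ) (v : tangentDir μ) : ∃ a : A, v = fieldX μ a ν := by
  have hv : (v : Module.Dual ℝ A) ∈ tangentDir (incl μ ν) := by
    rw [tangentDir_incl]; exact v.2
  obtain ⟨a, ha⟩ := hv
  exact ⟨a, Subtype.ext ha.symm⟩

lemma range_dincl (ν : Orbit μ) :
    Set.range (dincl μ ν) = {ξ | ∃ a : A, ξ = sharp (incl μ ν) a} := by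
  ext ξ
  constructor
  · rintro ⟨v, rfl⟩
    obtain ⟨a, ha⟩ := exists_eq_fieldX μ ν v
    exact ⟨a, (congrArg (dincl μ ν) ha).trans (dincl_fieldX μ ν a)⟩
  · rintro ⟨a, rfl⟩
    exact ⟨_, dincl_fieldX μ ν a⟩

variable {μ}

/-- In the affine chart `dincl` is the fixed inclusion of `tangentDir μ` into the dual, so it
commutes with differentiation and can be cancelled. -/
lemma isInducedConnection_iff {C : Connection (tangentDir μ) (Orbit μ)} :
    IsInducedConnection μ C ↔ HasChristoffel (orbitChart μ) C (fun _ => 0) := by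
  refine forall_congr' fun Y => forall_congr' fun hY => forall_congr' fun ν =>
    forall_congr' fun v => ?_
  have hy := hY.differentiableAt_coordField (chartAt_orbit μ) ν
  have h1 : (fun x => dincl μ x (Y x)) ∘ (orbitChart μ).symm =
      (tangentDir μ).subtypeL ∘ coordField (orbitChart μ) Y :=
    funext fun u => dincl_apply μ _ _
  have h2 : HasFDerivAt ((fun x => dincl μ x (Y x)) ∘ (orbitChart μ).symm) _ (orbitChart μ ν) :=
    h1.symm ▸ (tangentDir μ).subtypeL.hasFDerivAt.comp _ hy.hasFDerivAt
  have h3 : mvfderiv 𝓘(ℝ, tangentDir μ) (fun x => dincl μ x (Y x)) ν v =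
      (fderiv ℝ (coordField (orbitChart μ) Y) (orbitChart μ ν) v : tangentDir μ) := by
    refine (mvfderiv_eq_of_chartAt_eq (chartAt_orbit μ) h2.differentiableAt v).trans ?_
    rw [h2.fderiv]
    rfl
  rw [h3]
  have h4 := dincl_apply μ ν (C Y ν v)
  constructor
  · intro h
    refine (Subtype.ext (h4.symm.trans h)).trans ?_
    exact (add_zero (M := tangentDir μ) _).symm
  · intro h
    exact h4.trans (congrArg Subtype.val (h.trans (add_zero (M := tangentDir μ) _)))

variable (μ)

/-- The metric of the orbit. -/
noncomputable def orbitMetric : Metric (tangentDir μ) (Orbit μ) :=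
  (orbitData μ).metric (chartAt_orbit μ) (isUnit_shift_of_mem_target μ)

lemma orbitMetric_fieldX (ν : Orbit μ) (a b : A) :
    (orbitMetric μ).form ν (fieldX μ a ν) (fieldX μ b ν) = incl μ ν (a * b) := by
  rw [fieldX_eq, fieldX_eq]
  have hu := isUnit_shift_orbitChart μ ν
  change (orbitData μ).form ((orbitData μ).quot (orbitChart μ ν)
    ((orbitData μ).shift (orbitChart μ ν) (toDir μ a)))
    ((orbitData μ).shift (orbitChart μ ν) (toDir μ b)) = _
  rw [quot_shift hu, orbitData_form_toDir, shift_orbitChart_toDir, sharp_apply, mul_comm]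

lemma isInducedMetric_orbitMetric : IsInducedMetric μ (orbitMetric μ) := by
  intro ν v w a b hv hw
  have hv' : v = fieldX μ a ν := dincl_injective μ ν (hv.trans (dincl_fieldX μ ν a).symm)
  have hw' : w = fieldX μ b ν := dincl_injective μ ν (hw.trans (dincl_fieldX μ ν b).symm)
  rw [hv', hw', orbitMetric_fieldX]
  rfl

variable {μ}

/-- Every tangent vector is some `X_a(ν)`, so the bilinear form is determined; the other fields of
`Metric` are propositions. -/
lemma IsInducedMetric.eq_orbitMetric {g : Metric (tangentDir μ) (Orbit μ)}
    (hg : IsInducedMetric μ g) : g = orbitMetric μ := by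
  have h : g.form = (orbitMetric μ).form := by
    funext ν
    refine LinearMap.ext fun v => LinearMap.ext fun w => ?_
    obtain ⟨a, rfl⟩ := exists_eq_fieldX μ ν v
    obtain ⟨b, rfl⟩ := exists_eq_fieldX μ ν w
    rw [orbitMetric_fieldX]
    exact hg ν _ _ a b (dincl_fieldX μ ν a) (dincl_fieldX μ ν b)
  cases g
  cases horb : orbitMetric μ
  rw [horb] at h
  subst h
  rfl

lemma IsOrbitGeometry.hasChristoffel {C : Connection (tangentDir μ) (Orbit μ)}
    {g : Metric (tangentDir μ) (Orbit μ)} {D : Connection (tangentDir μ) (Orbit μ)}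
    (h : IsOrbitGeometry μ C g D) : HasChristoffel (orbitChart μ) C (fun _ => 0) ∧
      HasChristoffel (orbitChart μ) D (orbitData μ).christoffel := by
  refine ⟨isInducedConnection_iff.1 h.1, ?_⟩
  have hD := h.2.2
  rw [h.2.1.eq_orbitMetric] at hD
  exact hasChristoffel_of_isLeviCivita (chartAt_orbit μ) (isUnit_shift_of_mem_target μ) hD

variable (μ)

lemma exists_isOrbitGeometry :
    ∃ C g D, IsOrbitGeometry μ C g D ∧ IsPseudoHessian C g :=
  ⟨christoffelConnection (chartAt_orbit μ) fun _ => 0, orbitMetric μ,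
    christoffelConnection (chartAt_orbit μ) (orbitData μ).christoffel,
    ⟨isInducedConnection_iff.2 (hasChristoffel_christoffelConnection _ _),
      isInducedMetric_orbitMetric μ, isLeviCivita_christoffelConnection _ _⟩,
    isPseudoHessian_metric _ _⟩

lemma trace_dirMul_eq (ν : Orbit μ) (a : A) :
    LinearMap.trace ℝ (tangentDir μ) ((orbitData μ).mul (toDir μ a)) =
      LinearMap.trace ℝ _ (inducedMul (incl μ ν) a) := by
  -- The identification `b ↦ X_b(ν) = (1 + u)[b]`. As `1 + u` commutes with multiplication by `[a]`,
  -- it conjugates the endomorphism induced by `L_a` on `A / A_ν` into that multiplication.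
  let ψ : (A ⧸ LinearMap.ker (sharp (incl μ ν))) ≃ₗ[ℝ] tangentDir μ :=
    (sharp (incl μ ν)).quotKerEquivRange.trans (LinearEquiv.ofEq _ _ (tangentDir_incl μ ν))
  have hψ : ∀ b : A, ψ (Submodule.Quotient.mk b) =
      (orbitData μ).shift (orbitChart μ ν) (toDir μ b) :=
    fun b => Subtype.ext (shift_orbitChart_toDir μ ν b).symm
  rw [← LinearMap.trace_conj' (inducedMul (incl μ ν) a) ψ]
  congr 1
  refine LinearMap.ext fun v => ?_
  obtain ⟨q, rfl⟩ := ψ.surjective v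
  obtain ⟨b, rfl⟩ := Submodule.Quotient.mk_surjective _ q
  rw [LinearEquiv.conj_apply_apply, ψ.symm_apply_apply]
  change (orbitData μ).mul (toDir μ a) (ψ (Submodule.Quotient.mk b)) =
    ψ (Submodule.Quotient.mk (a * b))
  rw [hψ, hψ, mul_shift, orbitData_mul_toDir]

/-- The orbit lies in `μ + T`. If it is open, it contains `μ + tξ` for small `t`, and one such `t ≠
0` gives `ξ ∈ T`. -/
lemma tangentDir_eq_top_of_isOpen (h : IsOpen (Set.range (incl μ))) : tangentDir μ = ⊤ := by
  have hmem : ∀ ξ : Module.Dual ℝ A, ∀ᶠ t : ℝ in 𝓝 0, t • ξ ∈ tangentDir μ := by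
    intro ξ
    have hc : Filter.Tendsto (fun t : ℝ => μ + t • ξ) (𝓝 0) (𝓝 μ) := by
      have : ContinuousAt (fun t : ℝ => μ + t • ξ) 0 := by fun_prop
      simpa [ContinuousAt] using this
    have hμ : μ ∈ Set.range (incl μ) := ⟨⟨μ, 0, action_zero μ⟩, rfl⟩
    filter_upwards [hc.eventually (h.mem_nhds hμ)] with t ht
    obtain ⟨ν, hν⟩ := ht
    have := (chartMap μ ν).2
    rwa [show ((chartMap μ ν : tangentDir μ) : Module.Dual ℝ A) = incl μ ν - μ from rfl, hν,
      add_sub_cancel_left] at this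
  refine Submodule.eq_top_iff'.2 fun ξ => ?_
  obtain ⟨t, ht, ht0⟩ := ((hmem ξ).filter_mono nhdsWithin_le_nhds).and
    (self_mem_nhdsWithin (s := {0}ᶜ) (a := (0 : ℝ))) |>.exists
  exact ((tangentDir μ).smul_mem_iff ht0).1 ht

lemma trace_dirMul_eq_of_isOpen (h : IsOpen (Set.range (incl μ))) (a : A) :
    LinearMap.trace ℝ (tangentDir μ) ((orbitData μ).mul (toDir μ a)) =
      LinearMap.trace ℝ A (LinearMap.mulLeft ℝ a) := by
  -- `T` is the whole dual, of the same dimension as `A`, so `A_μ = 0` and `toDir μ` is an algebra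
  -- isomorphism.
  have hinj : Function.Injective (toDir μ) := by
    have h1 : Function.Injective (sharp μ) :=
      (LinearMap.injective_iff_surjective_of_finrank_eq_finrank
        Subspace.dual_finrank_eq.symm).2 (LinearMap.range_eq_top.1
          (tangentDir_eq_top_of_isOpen μ h))
    exact fun x y hxy => h1 (congrArg Subtype.val hxy)
  let ψ : A ≃ₗ[ℝ] tangentDir μ := LinearEquiv.ofBijective (toDir μ) ⟨hinj, toDir_surjective μ⟩
  rw [← LinearMap.trace_conj' (LinearMap.mulLeft ℝ a) ψ]
  congr 1
  refine LinearMap.ext fun v => ?_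
  obtain ⟨b, rfl⟩ := ψ.surjective v
  rw [LinearEquiv.conj_apply_apply, ψ.symm_apply_apply]
  exact orbitData_mul_toDir μ a b

variable {μ}

/-- A triple product `[abc]` is the functional `d ↦ μ(abcd)`, so it vanishes in `T` exactly when all
these values do. -/
lemma IsOrbitGeometry.hessianCurvatureVanishes_iff {C : Connection (tangentDir μ) (Orbit μ)}
    {g : Metric (tangentDir μ) (Orbit μ)} {D : Connection (tangentDir μ) (Orbit μ)}
    (h : IsOrbitGeometry μ C g D) :
    HessianCurvatureVanishes C D ↔ ∀ a b c d : A, μ (a * b * c * d) = 0 := by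
  rw [PseudoHessian.hessianCurvatureVanishes_iff (chartAt_orbit μ) (isUnit_shift_of_mem_target μ)
    h.hasChristoffel.1 h.hasChristoffel.2]
  constructor
  · intro H a b c d
    have h1 := H (toDir μ a) (toDir μ b) (toDir μ c)
    rw [orbitData_mul_toDir, orbitData_mul_toDir] at h1
    rw [← coe_toDir_apply, h1]
    rfl
  · intro H a b c
    obtain ⟨a, rfl⟩ := toDir_surjective μ a
    obtain ⟨b, rfl⟩ := toDir_surjective μ b
    obtain ⟨c, rfl⟩ := toDir_surjective μ c
    rw [orbitData_mul_toDir, orbitData_mul_toDir]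
    ext d
    exact H a b c d

end OrbitGeometry
end PseudoHessian

/-! ### The theorem -/

theorem proposition7p3 {A : Type*} [NonUnitalCommRing A] [Module ℝ A] [IsScalarTower ℝ A A]
    [SMulCommClass ℝ A A] [FiniteDimensional ℝ A] :
    (∀ μ : Module.Dual ℝ A,
      -- the orbit is an immersed submanifold of the dual with tangent spaces `{X_a(ν)}`
      (ContMDiff 𝓘(ℝ, PseudoHessian.tangentDir μ) 𝓘(ℝ, Module.Dual ℝ A) ∞
          (PseudoHessian.incl μ) ∧
        ∀ ν : PseudoHessian.Orbit μ,
          Function.Injective (PseudoHessian.dincl μ ν) ∧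
          Set.range (PseudoHessian.dincl μ ν) =
            {ξ | ∃ a : A, ξ = PseudoHessian.sharp (PseudoHessian.incl μ ν) a} ∧
          ∀ a : A, PseudoHessian.dincl μ ν (PseudoHessian.fieldX μ a ν) =
            PseudoHessian.sharp (PseudoHessian.incl μ ν) a) ∧
      (∀ a : A, PseudoHessian.IsSmooth (PseudoHessian.fieldX μ a)) ∧
      -- it carries an induced pseudo-Hessian structure, and this has a Levi-Civita connection
      (∃ C g D, PseudoHessian.IsOrbitGeometry μ C g D ∧ PseudoHessian.IsPseudoHessian C g) ∧
      ∀ C g D, PseudoHessian.IsOrbitGeometry μ C g D →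
        (∀ (a b : A) (ν : PseudoHessian.Orbit μ),
          g.form ν (PseudoHessian.fieldX μ a ν) (PseudoHessian.fieldX μ b ν) =
            PseudoHessian.incl μ ν (a * b)) ∧
        (∀ a b : A, PseudoHessian.nabla C (PseudoHessian.fieldX μ a) (PseudoHessian.fieldX μ b) =
          PseudoHessian.fieldX μ (a * b)) ∧
        (∀ a b : A, PseudoHessian.nabla D (PseudoHessian.fieldX μ a) (PseudoHessian.fieldX μ b) =
          (1 / 2 : ℝ) • PseudoHessian.fieldX μ (a * b)) ∧
        (∀ a b : A, PseudoHessian.nabla (PseudoHessian.dualConnection C D)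
          (PseudoHessian.fieldX μ a) (PseudoHessian.fieldX μ b) = 0) ∧
        (∀ a b c : A, PseudoHessian.hessianCurvature C D (PseudoHessian.fieldX μ a)
            (PseudoHessian.fieldX μ b) (PseudoHessian.fieldX μ c) =
          (1 / 2 : ℝ) • PseudoHessian.fieldX μ (a * b * c)) ∧
        (∀ (a : A) (ν : PseudoHessian.Orbit μ),
          PseudoHessian.koszulOne C D (PseudoHessian.fieldX μ a) ν =
            -(1 / 2) * LinearMap.trace ℝ _
              (PseudoHessian.inducedMul (PseudoHessian.incl μ ν) a)) ∧
        (∀ (a b : A) (ν : PseudoHessian.Orbit μ),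
          PseudoHessian.koszulTwo C D (PseudoHessian.fieldX μ a) (PseudoHessian.fieldX μ b) ν =
            1 / 2 * LinearMap.trace ℝ _
              (PseudoHessian.inducedMul (PseudoHessian.incl μ ν) (a * b))) ∧
        -- if the orbit is open in the dual, these are the traces of `L_a` and `L_{ab}` themselves
        (IsOpen (Set.range (PseudoHessian.incl μ)) →
          (∀ (a : A) (ν : PseudoHessian.Orbit μ),
            PseudoHessian.koszulOne C D (PseudoHessian.fieldX μ a) ν =
              -(1 / 2) * LinearMap.trace ℝ A (LinearMap.mulLeft ℝ a)) ∧
          (∀ (a b : A) (ν : PseudoHessian.Orbit μ),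
            PseudoHessian.koszulTwo C D (PseudoHessian.fieldX μ a) (PseudoHessian.fieldX μ b) ν =
              1 / 2 * LinearMap.trace ℝ A (LinearMap.mulLeft ℝ (a * b)))) ∧
        PseudoHessian.IsFlat D ∧
        (PseudoHessian.HessianCurvatureVanishes C D ↔ ∀ a b c d : A, μ (a * b * c * d) = 0)) ∧
    ((∀ (μ : Module.Dual ℝ A) C g D, PseudoHessian.IsOrbitGeometry μ C g D →
        PseudoHessian.HessianCurvatureVanishes C D) ↔
      ∀ a b c d : A, a * b * c * d = 0) := by
  refine ⟨fun μ => ⟨⟨PseudoHessian.contMDiff_incl μ, fun ν => ⟨PseudoHessian.dincl_injective μ ν,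
    PseudoHessian.range_dincl μ ν, PseudoHessian.dincl_fieldX μ ν⟩⟩, fun a => ?_,
    PseudoHessian.exists_isOrbitGeometry μ, fun C g D h => ?_⟩, ?_⟩
  · rw [PseudoHessian.fieldX_eq]
    exact PseudoHessian.FrobeniusData.isSmooth_field (PseudoHessian.chartAt_orbit μ) _
  · have he := PseudoHessian.chartAt_orbit μ
    have hS := PseudoHessian.isUnit_shift_of_mem_target μ
    obtain ⟨hC, hD⟩ := h.hasChristoffel
    have hα : ∀ (a : A) (ν : PseudoHessian.Orbit μ),
        PseudoHessian.koszulOne C D (PseudoHessian.fieldX μ a) ν = -(1 / 2) * LinearMap.trace ℝ _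
          ((PseudoHessian.orbitData μ).mul (PseudoHessian.toDir μ a) :
            PseudoHessian.tangentDir μ →ₗ[ℝ] PseudoHessian.tangentDir μ) := by
      intro a ν
      rw [PseudoHessian.fieldX_eq]
      exact PseudoHessian.koszulOne_field he hS hC hD _ ν
    have hβ : ∀ (a b : A) (ν : PseudoHessian.Orbit μ),
        PseudoHessian.koszulTwo C D (PseudoHessian.fieldX μ a) (PseudoHessian.fieldX μ b) ν =
          1 / 2 * LinearMap.trace ℝ _
            ((PseudoHessian.orbitData μ).mul (PseudoHessian.toDir μ (a * b)) :
              PseudoHessian.tangentDir μ →ₗ[ℝ] PseudoHessian.tangentDir μ) := by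
      intro a b ν
      rw [PseudoHessian.fieldX_eq, PseudoHessian.fieldX_eq, ← PseudoHessian.orbitData_mul_toDir]
      exact PseudoHessian.koszulTwo_field he hS hC hD _ _ ν
    refine ⟨fun a b ν => ?_, fun a b => ?_, fun a b => ?_, fun a b => ?_, fun a b c => ?_,
      fun a ν => ?_, fun a b ν => ?_, fun hopen => ⟨fun a ν => ?_, fun a b ν => ?_⟩,
      PseudoHessian.isFlat_of_hasChristoffel he hS hD, h.hessianCurvatureVanishes_iff⟩
    · rw [h.2.1.eq_orbitMetric, PseudoHessian.orbitMetric_fieldX]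
    · simp only [PseudoHessian.fieldX_eq, ← PseudoHessian.orbitData_mul_toDir]
      exact PseudoHessian.nabla_field_of_zero he hC _ _
    · simp only [PseudoHessian.fieldX_eq, ← PseudoHessian.orbitData_mul_toDir]
      exact PseudoHessian.nabla_field he hS hD _ _
    · simp only [PseudoHessian.fieldX_eq]
      exact PseudoHessian.nabla_dualConnection_field he hS hC hD _ _
    · simp only [PseudoHessian.fieldX_eq, ← PseudoHessian.orbitData_mul_toDir]
      exact PseudoHessian.hessianCurvature_field he hS hC hD _ _ _
    · rw [hα, PseudoHessian.trace_dirMul_eq μ ν]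
    · rw [hβ, PseudoHessian.trace_dirMul_eq μ ν]
    · rw [hα, PseudoHessian.trace_dirMul_eq_of_isOpen μ hopen]
    · rw [hβ, PseudoHessian.trace_dirMul_eq_of_isOpen μ hopen]
  · constructor
    · intro H a b c d
      -- Functionals separate points of `A`. For each `μ` an orbit geometry exists, so the
      -- hypothesis on all orbits is not vacuous there.
      refine (Module.forall_dual_apply_eq_zero_iff ℝ _).1 fun μ => ?_
      obtain ⟨C, g, D, h, -⟩ := PseudoHessian.exists_isOrbitGeometry μ
      exact h.hessianCurvatureVanishes_iff.1 (H μ C g D h) a b c d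
    · intro H μ C g D h
      exact h.hessianCurvatureVanishes_iff.2 fun a b c d => by rw [H, map_zero]
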